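/- Let $X_1,\dots,X_n\in\mathbb{R}$ be fixed data that are not all equal, let $\mathrm{conv}(X)=[\min_i X_i,\max_i X_i]$, and let $\mathbb{Q}_n=\frac1n\sum_{i=1}^n\delta_{X_i}$. Let $\mathcal{G}(X)$ be the class of lower semicontinuous convex functions $g:\mathbb{R}\to[0,\infty]$ with $g=\infty$ outside $\mathrm{conv}(X)$. For $\alpha=1+s\in(0,1)$ sufficiently close to $1$ and $\beta=1+1/s$, let $f_\alpha$ be the Rényi divergence estimator, which is given in either of the following two ways: (a) $f_\alpha=g_\alpha^{1/s}$, where $g_\alpha$ minimizes $\int g\,d\mathbb{Q}_n+\frac{1}{|\beta|}\int_{\mathbb{R}} g(x)^\beta\,dx$ over $g\in\mathcal{G}(X)$; or (b) $f_\alpha$ is the solution of the dual problem of minimizing $F_\alpha(f)=\frac{1}{\alpha-1}\log\int f(x)^\alpha\,dx$ over all probability densities $f$ on $\mathbb{R}$ such that $\int g f\,dx\le\int g\,d\mathbb{Q}_n$ for every $g\in\mathcal{G}(X)$. Let $f_1$ be the log-concave maximum likelihood estimator, which is given in either of the following two ways: (a) $f_1$ maximizes $\prod_{i=1}^n f(X_i)$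 over all upper semicontinuous log-concave probability densities $f$ on $\mathbb{R}$; or (b) $f_1$ minimizes $F_1(f)=\int f(x)\log f(x)\,dx\in(-\infty,\infty]$ over the same constraint set as in the dual problem above. Solutions of the dual problems, which are determined only up to null sets, are represented by the version that is continuous on $\mathrm{conv}(X)$ and $0$ elsewhere. Then for all $\kappa>0$ and $p\ge1$, $$\lim_{\alpha\nearrow1}\int_{\mathbb{R}}(1+|x|)^\kappa\,|f_\alpha(x)-f_1(x)|^p\,dx=0.$$ Moreover, for every closed set $S\subseteq\mathbb{R}$ contained in the set of continuity points of $f_1$ and every $\kappa>0$, $$\lim_{\alpha\nearrow1}\ \sup_{x\in S}\,(1+|x|)^\kappa\,|f_\alpha(x)-f_1(x)|=0.$$ -/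

import Mathlib

open MeasureTheory Filter Topology
open scoped NNReal ENNReal

noncomputable section

/-- The convex hull `conv(X)` of the data `X 0, …, X (n - 1)` on the real line. -/
def dataHull {n : ℕ} (X : Fin n → ℝ) : Set ℝ :=
  convexHull ℝ (Set.range X)

/-- The empirical measure `n⁻¹ ∑ i, δ_{X i}`. -/
def empiricalMeasure {n : ℕ} (X : Fin n → ℝ) : Measure ℝ :=
  (n : ℝ≥0∞)⁻¹ • ∑ i, Measure.dirac (X i)

/-- The class `𝒢(X)` of nonnegative closed (i.e. lower semicontinuous) convex functions with
values in `[0, ∞]` that are supported on `conv(X)`, i.e. equal to `∞` outside of `conv(X)`. -/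
def convexClass {n : ℕ} (X : Fin n → ℝ) : Set (ℝ → ℝ≥0∞) :=
  {g | ConvexOn ℝ≥0 Set.univ g ∧ LowerSemicontinuous g ∧ ∀ x, x ∉ dataHull X → g x = ∞}

/-- The primal functional `L_s(g, Q) = ∫ g dQ + |β|⁻¹ ∫ g ^ β dx`, where `β = 1 + 1 / s`.
For `-1 < s < 0` one has `β < 0`, and the conventions `∞ ^ β = 0`, `0 ^ β = ∞` hold. -/
def primalFunctional (s : ℝ) (Q : Measure ℝ) (g : ℝ → ℝ≥0∞) : ℝ≥0∞ :=
  ∫⁻ x, g x ∂Q + ENNReal.ofReal (1 / |1 + 1 / s|) * ∫⁻ x, g x ^ (1 + 1 / s)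

/-- `f` is the Rényi divergence estimator with index `α = 1 + s` for the data `X`: it is
`g ^ (1 / s)` for a minimizer `g` of `L_s(·, ℚ_n)` over `𝒢(X)`. -/
def IsRenyiEstimator {n : ℕ} (X : Fin n → ℝ) (α : ℝ) (f : ℝ → ℝ) : Prop :=
  ∃ g ∈ convexClass X,
    (∀ h ∈ convexClass X, primalFunctional (α - 1) (empiricalMeasure X) g ≤
      primalFunctional (α - 1) (empiricalMeasure X) h) ∧
    ∀ x, f x = (g x ^ (1 / (α - 1))).toReal

/-- `f` is a probability density on the line. -/
structure IsDensity (f : ℝ → ℝ) : Prop where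
  nonneg : ∀ x, 0 ≤ f x
  integrable : Integrable f
  integral_eq_one : ∫ x, f x = 1

/-- `f` is an upper semicontinuous log-concave probability density. -/
structure IsLogConcaveDensity (f : ℝ → ℝ) : Prop extends IsDensity f where
  usc : UpperSemicontinuous f
  logConcave : ∀ x y a b : ℝ, 0 ≤ a → 0 ≤ b → a + b = 1 →
    f x ^ a * f y ^ b ≤ f (a * x + b * y)

/-- `f` is the log-concave maximum likelihood estimator for the data `X`: it maximizes the
likelihood `∏ i, f (X i)` among all (upper semicontinuous) log-concave densities. -/
def IsLogConcaveMLE {n : ℕ} (X : Fin n → ℝ) (f : ℝ → ℝ) : Prop :=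
  IsLogConcaveDensity f ∧ ∀ h, IsLogConcaveDensity h → ∏ i, h (X i) ≤ ∏ i, f (X i)

/-- The constraint of the dual problems: `f` is a density, and the signed measure `f dx - ℚ_n`
belongs to the polar cone of `𝒢(X)`, i.e. `∫ g f dx ≤ ∫ g dℚ_n` for all `g ∈ 𝒢(X)`.
(The case of the function `g ∈ 𝒢(X)` that vanishes on `conv(X)` shows that `f` vanishes almost
everywhere outside of `conv(X)`.) -/
def IsDualFeasible {n : ℕ} (X : Fin n → ℝ) (f : ℝ → ℝ) : Prop :=
  IsDensity f ∧ ∀ g ∈ convexClass X,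
    ∫⁻ x, g x * ENNReal.ofReal (f x) ≤ ∫⁻ x, g x ∂(empiricalMeasure X)

/-- The objective `F_α(f) = (α - 1)⁻¹ log ∫ f ^ α dx` of the dual problem, for `0 < α < 1`.
On the feasible set, `f ^ α` is integrable with a positive integral. -/
def dualObjective (α : ℝ) (f : ℝ → ℝ) : EReal :=
  ((1 / (α - 1) * Real.log (∫ x, f x ^ α) : ℝ) : EReal)

open Classical in
/-- The objective `F_1(f) = ∫ f log f dx`, with values in `(-∞, ∞]`.  On the feasible set the
negative part of `f log f` is integrable, so `f log f` can fail to be integrable only if the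
integral is `∞`. -/
def dualObjectiveOne (f : ℝ → ℝ) : EReal :=
  if Integrable (fun x => f x * Real.log (f x)) then
    ((∫ x, f x * Real.log (f x) : ℝ) : EReal) else ⊤

/-- `f` minimizes the objective `F` over the dual feasible set.  As such an `f` is
determined up to null sets only, `f` is taken to be the version that is continuous on `conv(X)`
and `0` elsewhere. -/
structure IsDualSolution {n : ℕ} (X : Fin n → ℝ) (F : (ℝ → ℝ) → EReal) (f : ℝ → ℝ) : Prop where
  feasible : IsDualFeasible X f
  minimal : ∀ h, IsDualFeasible X h → F f ≤ F h
  continuousOn : ContinuousOn f (dataHull X)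
  eq_zero : ∀ x, x ∉ dataHull X → f x = 0

end

/-! Put σ = 1 - α. Every optimal function is determined by a vector `w` of values at the data: with
u = `lowerHull X w`, the Rényi estimator is (1 + σu)^(-1/σ) on conv(X), and as σ → 0 this tends to
exp(-u).

Raising a convex function to the lower hull of its values at the data leaves ∫ g dℚ_n unchanged and
lowers ∫ g^β, so the primal problem is finite dimensional. Its first order conditions, written for
`w`, are collected in `IsCritical`: f has mass one, ∫ f · hull(z) ≤ mean(z) for every z, and the
reverse inequality holds for z = w. The parameter σ enters them only through f, so they survive the
limit (`IsCritical.of_tendsto`).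

Three facts then suffice. The vectors `w` stay in a fixed ball (`exists_bound_of_isCritical`):
Bernoulli's inequality bounds their mean, and a very negative minimum of u would force the mass of f
above one. The power converges to the exponential uniformly on bounded sets of u
(`abs_rpow_neg_inv_sub_exp_le`). Finally, the conditions identify the estimators: strict Bernoulli
for α < 1 (`IsDualSolution.eq_renyiDensity`), and the equality case of Gibbs' inequality for both
versions at α = 1 (`IsDualSolution.eq_exp_neg`, `IsLogConcaveMLE.eq_indicator`).

Hence all subsequential limits of the Rényi estimators agree with f₁. The convergence is uniform on
the compact set conv(X), and all functions vanish off it, so the weights and the exponent p are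
harmless. -/

/-- On a compact interval a lower semicontinuous convex function is continuous. -/
theorem ConvexOn.continuousOn_Icc_of_lowerSemicontinuousOn {h : ℝ → ℝ} {A B : ℝ} (hAB : A < B)
    (hc : ConvexOn ℝ (Set.Icc A B) h) (hl : LowerSemicontinuousOn h (Set.Icc A B)) :
    ContinuousOn h (Set.Icc A B) := by
  have hBA : 0 < B - A := sub_pos.2 hAB
  have hchord : ∀ x ∈ Set.Icc A B,
      h x ≤ (B - x) / (B - A) * h A + (x - A) / (B - A) * h B := by
    intro x hx
    have h1 : 0 ≤ (B - x) / (B - A) := div_nonneg (sub_nonneg.2 hx.2) hBA.le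
    have h2 : 0 ≤ (x - A) / (B - A) := div_nonneg (sub_nonneg.2 hx.1) hBA.le
    have := hc.2 (Set.left_mem_Icc.2 hAB.le) (Set.right_mem_Icc.2 hAB.le) h1 h2
      (by field_simp; ring)
    have he : (B - x) / (B - A) * A + (x - A) / (B - A) * B = x := by field_simp; ring
    simpa only [smul_eq_mul, he] using this
  -- At an endpoint the chord takes the value of `h`, so it controls `h` from above and
  -- semicontinuity controls it from below. Interior points need only convexity.
  have key : ∀ x ∈ Set.Icc A B,
      (B - x) / (B - A) * h A + (x - A) / (B - A) * h B = h x →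
      ContinuousWithinAt h (Set.Icc A B) x := by
    intro x hx hxe
    rw [ContinuousWithinAt, tendsto_order]
    refine ⟨fun a ha => hl x hx a ha, fun a ha => ?_⟩
    have hcont : Continuous fun x : ℝ => (B - x) / (B - A) * h A + (x - A) / (B - A) * h B := by
      fun_prop
    have := (hcont.tendsto x).eventually (gt_mem_nhds (hxe.trans_lt ha))
    filter_upwards [mem_nhdsWithin_of_mem_nhds this, self_mem_nhdsWithin] with z hz hzI
    exact (hchord z hzI).trans_lt hz
  refine hc.continuousOn_Icc hAB ?_ ?_
  · rw [← continuousWithinAt_Icc_iff_Ici hAB]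
    exact key A (Set.left_mem_Icc.2 hAB.le) (by field_simp; ring)
  · rw [← continuousWithinAt_Icc_iff_Iic hAB]
    exact key B (Set.right_mem_Icc.2 hAB.le) (by field_simp; ring)

/-! ### Lower hulls of data values -/

/-- The largest closed convex function whose value at `X i` is at most `y i` for all `i`, as a
supremum of affine functions. -/
noncomputable def lowerHull {n : ℕ} (X y : Fin n → ℝ) (x : ℝ) : ℝ :=
  sSup {t | ∃ a b : ℝ, (∀ i, a * X i + b ≤ y i) ∧ a * x + b = t}

section lowerHull

variable {n : ℕ} {X y z : Fin n → ℝ} {x : ℝ}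

theorem mem_dataHull (X : Fin n → ℝ) (i : Fin n) : X i ∈ dataHull X :=
  subset_convexHull ℝ _ ⟨i, rfl⟩

theorem affine_le_of_mem_dataHull {a b c : ℝ} (h : ∀ i, a * X i + b ≤ c) (hx : x ∈ dataHull X) :
    a * x + b ≤ c := by
  have hconv : Convex ℝ {x : ℝ | a * x + b ≤ c} := by
    intro u hu v hv p q hp hq hpq
    simp only [Set.mem_ofPred_eq, smul_eq_mul] at hu hv ⊢
    have h1 := mul_le_mul_of_nonneg_left hu hp
    have h2 := mul_le_mul_of_nonneg_left hv hq
    calc a * (p * u + q * v) + b = p * (a * u + b) + q * (a * v + b) := by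
          linear_combination (-b) * hpq
      _ ≤ p * c + q * c := add_le_add h1 h2
      _ = c := by rw [← add_mul, hpq, one_mul]
  exact convexHull_min (by rintro _ ⟨i, rfl⟩; exact h i) hconv hx

theorem lowerHull_nonempty (X y : Fin n → ℝ) (x : ℝ) :
    {t | ∃ a b : ℝ, (∀ i, a * X i + b ≤ y i) ∧ a * x + b = t}.Nonempty :=
  ⟨_, 0, -‖y‖, fun i => by
    have := norm_le_pi_norm y i
    rw [Real.norm_eq_abs] at this
    linarith [neg_abs_le (y i)], rfl⟩

theorem lowerHull_bddAbove (y : Fin n → ℝ) (hx : x ∈ dataHull X) :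
    BddAbove {t | ∃ a b : ℝ, (∀ i, a * X i + b ≤ y i) ∧ a * x + b = t} := by
  refine ⟨‖y‖, ?_⟩
  rintro _ ⟨a, b, h, rfl⟩
  exact affine_le_of_mem_dataHull
    (fun i => (h i).trans ((le_abs_self _).trans (norm_le_pi_norm y i))) hx

theorem affine_le_lowerHull {a b : ℝ} (hx : x ∈ dataHull X) (h : ∀ i, a * X i + b ≤ y i) :
    a * x + b ≤ lowerHull X y x :=
  le_csSup (lowerHull_bddAbove y hx) ⟨a, b, h, rfl⟩

theorem lowerHull_le {c : ℝ} (h : ∀ a b : ℝ, (∀ i, a * X i + b ≤ y i) → a * x + b ≤ c) :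
    lowerHull X y x ≤ c := by
  refine csSup_le (lowerHull_nonempty X y x) ?_
  rintro _ ⟨a, b, hab, rfl⟩
  exact h a b hab

theorem lowerHull_apply_le (X y : Fin n → ℝ) (i : Fin n) : lowerHull X y (X i) ≤ y i :=
  lowerHull_le fun _ _ h => h i

theorem lowerHull_le_of_le {c : ℝ} (hx : x ∈ dataHull X) (h : ∀ i, y i ≤ c) :
    lowerHull X y x ≤ c :=
  lowerHull_le fun _ _ hab => affine_le_of_mem_dataHull (fun i => (hab i).trans (h i)) hx

theorem le_lowerHull_of_le {c : ℝ} (hx : x ∈ dataHull X) (h : ∀ i, c ≤ y i) :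
    c ≤ lowerHull X y x := by
  simpa using affine_le_lowerHull (a := 0) (b := c) hx (by simpa using h)

theorem lowerHull_const (hx : x ∈ dataHull X) (c : ℝ) : lowerHull X (fun _ => c) x = c :=
  le_antisymm (lowerHull_le_of_le hx fun _ => le_rfl) (le_lowerHull_of_le hx fun _ => le_rfl)

theorem lowerHull_add_le (hx : x ∈ dataHull X) :
    lowerHull X y x + lowerHull X z x ≤ lowerHull X (y + z) x := by
  rw [← le_sub_iff_add_le]
  refine lowerHull_le fun a b h => ?_
  rw [le_sub_comm]
  refine lowerHull_le fun a' b' h' => ?_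
  have := affine_le_lowerHull (a := a + a') (b := b + b') (y := y + z) hx fun i => by
    have := h i; have := h' i; simp only [Pi.add_apply]; linarith
  linarith

theorem lowerHull_mono (hx : x ∈ dataHull X) (h : ∀ i, y i ≤ z i) :
    lowerHull X y x ≤ lowerHull X z x :=
  lowerHull_le fun _ _ hab => affine_le_lowerHull hx fun i => (hab i).trans (h i)

theorem le_lowerHull_affine (hx : x ∈ dataHull X) {c : ℝ} (hc : 0 < c) (d : ℝ) :
    c * lowerHull X y x + d ≤ lowerHull X (fun i => c * y i + d) x := by
  rw [← le_sub_iff_add_le, ← le_div_iff₀' hc]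
  refine lowerHull_le fun a b h => ?_
  rw [le_div_iff₀' hc, le_sub_iff_add_le]
  have := affine_le_lowerHull (a := c * a) (b := c * b + d) (y := fun i => c * y i + d) hx
    fun i => by nlinarith [h i]
  linarith

/-- The missing inequality is the one-sided version for the inverse affine map. Exactness is what
permits the substitution y = 1 + σw later. -/
theorem lowerHull_affine (hx : x ∈ dataHull X) {c : ℝ} (hc : 0 < c) (d : ℝ) :
    lowerHull X (fun i => c * y i + d) x = c * lowerHull X y x + d := by
  refine le_antisymm ?_ (le_lowerHull_affine hx hc d)
  have h := le_lowerHull_affine (y := fun i => c * y i + d) hx (inv_pos.2 hc) (-(c⁻¹ * d))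
  have he : (fun i => c⁻¹ * (c * y i + d) + -(c⁻¹ * d)) = y := by
    ext i; field_simp; ring
  rw [he] at h
  have := mul_le_mul_of_nonneg_left h hc.le
  field_simp at this
  linarith

/-- Monotonicity and translation give a Lipschitz bound uniform in `x`; all convergence of hulls is
read off from convergence of vectors. -/
theorem abs_lowerHull_sub_le (hx : x ∈ dataHull X) :
    |lowerHull X y x - lowerHull X z x| ≤ ‖y - z‖ := by
  have key : ∀ y z : Fin n → ℝ, lowerHull X y x ≤ lowerHull X z x + ‖y - z‖ := by
    intro y z
    have h1 : lowerHull X y x ≤ lowerHull X (fun i => 1 * z i + ‖y - z‖) x :=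
      lowerHull_mono hx fun i => by
        have := (le_abs_self _).trans (norm_le_pi_norm (y - z) i)
        simp only [Pi.sub_apply] at this
        linarith
    rwa [lowerHull_affine hx one_pos, one_mul] at h1
  rw [abs_le]
  have h1 := key y z
  have h2 := key z y
  rw [norm_sub_rev] at h2
  constructor <;> linarith

theorem convex_dataHull (X : Fin n → ℝ) : Convex ℝ (dataHull X) := convex_convexHull ℝ _

theorem isCompact_dataHull (X : Fin n → ℝ) : IsCompact (dataHull X) :=
  (Set.finite_range X).isCompact_convexHull ℝ

theorem convexOn_lowerHull (X y : Fin n → ℝ) : ConvexOn ℝ (dataHull X) (lowerHull X y) := by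
  refine ⟨convex_dataHull X, fun u hu v hv p q hp hq hpq => lowerHull_le fun a b h => ?_⟩
  have h1 := mul_le_mul_of_nonneg_left (affine_le_lowerHull hu h) hp
  have h2 := mul_le_mul_of_nonneg_left (affine_le_lowerHull hv h) hq
  simp only [smul_eq_mul]
  have : a * (p * u + q * v) + b = p * (a * u + b) + q * (a * v + b) := by
    linear_combination (-b) * hpq
  linarith

theorem lowerSemicontinuousOn_lowerHull (X y : Fin n → ℝ) :
    LowerSemicontinuousOn (lowerHull X y) (dataHull X) := by
  intro u hu c hc
  obtain ⟨_, ⟨a, b, h, rfl⟩, hab⟩ := exists_lt_of_lt_csSup (lowerHull_nonempty X y u) hc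
  have hcont : Continuous fun x : ℝ => a * x + b := by fun_prop
  filter_upwards [mem_nhdsWithin_of_mem_nhds ((hcont.tendsto u).eventually (lt_mem_nhds hab)),
    self_mem_nhdsWithin] with v hv hvI
  exact hv.trans_le (affine_le_lowerHull hvI h)

theorem exists_dataHull_eq_Icc (hX : (interior (dataHull X)).Nonempty) :
    ∃ A B : ℝ, A < B ∧ dataHull X = Set.Icc A B := by
  have hne : (dataHull X).Nonempty := hX.mono interior_subset
  have h := eq_Icc_of_connected_compact ⟨hne, (convex_dataHull X).isPreconnected⟩
    (isCompact_dataHull X)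
  refine ⟨_, _, ?_, h⟩
  rw [h, interior_Icc] at hX
  exact Set.nonempty_Ioo.1 hX

theorem continuousOn_of_convexOn_dataHull (hX : (interior (dataHull X)).Nonempty) {h : ℝ → ℝ}
    (hc : ConvexOn ℝ (dataHull X) h) (hl : LowerSemicontinuousOn h (dataHull X)) :
    ContinuousOn h (dataHull X) := by
  obtain ⟨A, B, hAB, hI⟩ := exists_dataHull_eq_Icc hX
  rw [hI] at hc hl ⊢
  exact hc.continuousOn_Icc_of_lowerSemicontinuousOn hAB hl

theorem continuousOn_lowerHull (hX : (interior (dataHull X)).Nonempty) (y : Fin n → ℝ) :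
    ContinuousOn (lowerHull X y) (dataHull X) :=
  continuousOn_of_convexOn_dataHull hX (convexOn_lowerHull X y)
    (lowerSemicontinuousOn_lowerHull X y)

/-- A closed convex function is the supremum of its affine minorants, and each of these competes in
the supremum defining the hull. This reduces function-valued problems to vectors. -/
theorem le_lowerHull_of_convexOn {h : ℝ → ℝ} (hc : ConvexOn ℝ (dataHull X) h)
    (hl : LowerSemicontinuousOn h (dataHull X)) (hx : x ∈ dataHull X) :
    h x ≤ lowerHull X (fun i => h (X i)) x := by
  refine le_of_forall_lt fun c hcx => ?_
  obtain ⟨c', hc1, hc2⟩ := exists_between hcx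
  obtain ⟨a, b, hab, habx⟩ :=
    hc.exists_affine_le_of_lt_real hx hc2 (isCompact_dataHull X).isClosed hl
  exact hc1.trans_le (habx ▸ affine_le_lowerHull hx fun i => hab _ (mem_dataHull X i))

/-! ### Lower hulls as members of `convexClass`, and empirical means -/

open Classical in
/-- The element of `convexClass X` given by `lowerHull X y`. -/
noncomputable def extHull (X y : Fin n → ℝ) (x : ℝ) : ℝ≥0∞ :=
  if x ∈ dataHull X then ENNReal.ofReal (lowerHull X y x) else ∞

theorem extHull_of_mem (y : Fin n → ℝ) (hx : x ∈ dataHull X) :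
    extHull X y x = ENNReal.ofReal (lowerHull X y x) := if_pos hx

theorem extHull_of_notMem (y : Fin n → ℝ) (hx : x ∉ dataHull X) : extHull X y x = ∞ := if_neg hx

theorem extHull_mem_convexClass (hy : ∀ i, 0 ≤ y i) : extHull X y ∈ convexClass X := by
  refine ⟨⟨convex_univ, ?_⟩, ?_, fun x hx => extHull_of_notMem y hx⟩
  · intro u _ v _ p q _ _ hpq
    -- Zero weights are separated because 0 * ∞ = 0; with positive weights an infinite endpoint
    -- value makes the right side infinite.
    rcases eq_or_ne p 0 with rfl | hp
    · simp only [zero_add] at hpq; subst hpq; simp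
    rcases eq_or_ne q 0 with rfl | hq
    · simp only [add_zero] at hpq; subst hpq; simp
    by_cases hu : u ∈ dataHull X
    swap
    · rw [extHull_of_notMem y hu]; simp [ENNReal.smul_def, hp]
    by_cases hv : v ∈ dataHull X
    swap
    · rw [extHull_of_notMem y hv]; simp [ENNReal.smul_def, hq]
    have hpq' : (p : ℝ) + q = 1 := by exact_mod_cast hpq
    have hm : p • u + q • v ∈ dataHull X := convex_dataHull X hu hv p.2 q.2 hpq'
    rw [extHull_of_mem y hu, extHull_of_mem y hv, extHull_of_mem y hm, ENNReal.smul_def,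
      ENNReal.smul_def, smul_eq_mul, smul_eq_mul, ← ENNReal.ofReal_coe_nnreal,
      ← ENNReal.ofReal_coe_nnreal, ← ENNReal.ofReal_mul p.coe_nonneg, ← ENNReal.ofReal_mul q.coe_nonneg,
      ← ENNReal.ofReal_add (mul_nonneg p.coe_nonneg (le_lowerHull_of_le hu hy))
        (mul_nonneg q.coe_nonneg (le_lowerHull_of_le hv hy))]
    exact ENNReal.ofReal_le_ofReal ((convexOn_lowerHull X y).2 hu hv p.2 q.2 hpq')
  · intro u c hc
    by_cases hu : u ∈ dataHull X
    · rw [extHull_of_mem y hu] at hc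
      have hc' : c.toReal < lowerHull X y u := by
        have := (ENNReal.lt_ofReal_iff_toReal_lt hc.ne_top).1 hc
        exact this
      have h1 := lowerSemicontinuousOn_lowerHull X y u hu _ hc'
      rw [eventually_nhdsWithin_iff] at h1
      filter_upwards [h1] with v hv
      by_cases hvI : v ∈ dataHull X
      · rw [extHull_of_mem y hvI]
        exact (ENNReal.lt_ofReal_iff_toReal_lt hc.ne_top).2 (hv hvI)
      · rw [extHull_of_notMem y hvI]
        exact hc.ne_top.lt_top
    · rw [extHull_of_notMem y hu] at hc
      filter_upwards [(isCompact_dataHull X).isClosed.isOpen_compl.mem_nhds hu] with v hv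
      rwa [extHull_of_notMem y hv]

theorem lintegral_empiricalMeasure (X : Fin n → ℝ) (g : ℝ → ℝ≥0∞) :
    ∫⁻ x, g x ∂(empiricalMeasure X) = (n : ℝ≥0∞)⁻¹ * ∑ i, g (X i) := by
  simp [empiricalMeasure, lintegral_smul_measure, lintegral_finsetSum_measure]

/-- The average of the entries of a vector. -/
noncomputable def vecMean (y : Fin n → ℝ) : ℝ := (n : ℝ)⁻¹ * ∑ i, y i

theorem lintegral_empiricalMeasure_ofReal (hn : 0 < n) (X : Fin n → ℝ) {g : ℝ → ℝ≥0∞}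
    (hg : ∀ i, g (X i) ≠ ∞) :
    ∫⁻ x, g x ∂(empiricalMeasure X) = ENNReal.ofReal (vecMean fun i => (g (X i)).toReal) := by
  rw [lintegral_empiricalMeasure, vecMean, ENNReal.ofReal_mul (by positivity),
    ENNReal.ofReal_sum_of_nonneg (fun i _ => ENNReal.toReal_nonneg),
    ENNReal.ofReal_inv_of_pos (by exact_mod_cast hn), ENNReal.ofReal_natCast]
  simp_rw [fun i => ENNReal.ofReal_toReal (hg i)]

theorem lintegral_empiricalMeasure_extHull_le (hn : 0 < n) (hy : ∀ i, 0 ≤ y i) :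
    ∫⁻ x, extHull X y x ∂(empiricalMeasure X) ≤ ENNReal.ofReal (vecMean y) := by
  have hX := mem_dataHull X
  rw [lintegral_empiricalMeasure_ofReal hn X
    (fun i => by rw [extHull_of_mem y (hX i)]; exact ENNReal.ofReal_ne_top)]
  refine ENNReal.ofReal_le_ofReal (mul_le_mul_of_nonneg_left ?_ (by positivity))
  refine Finset.sum_le_sum fun i _ => ?_
  rw [extHull_of_mem y (hX i), ENNReal.toReal_ofReal (le_lowerHull_of_le (hX i) hy)]
  exact lowerHull_apply_le X y i

theorem vecMean_add (y z : Fin n → ℝ) : vecMean (y + z) = vecMean y + vecMean z := by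
  simp [vecMean, Finset.sum_add_distrib, mul_add]

theorem vecMean_affine (hn : 0 < n) (y : Fin n → ℝ) (c d : ℝ) :
    vecMean (fun i => c * y i + d) = c * vecMean y + d := by
  have : (n : ℝ) ≠ 0 := by exact_mod_cast hn.ne'
  simp only [vecMean, Finset.sum_add_distrib, ← Finset.mul_sum, Finset.sum_const,
    Finset.card_univ, Fintype.card_fin, nsmul_eq_mul]
  field_simp

theorem pos_of_interior_dataHull_nonempty (hX : (interior (dataHull X)).Nonempty) : 0 < n := by
  rcases Nat.eq_zero_or_pos n with rfl | h
  · have : dataHull X = ∅ := by simp [dataHull, Set.range_eq_empty]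
    simp [this] at hX
  · exact h

end lowerHull

/-! ### The primal problem as a minimization over vectors -/

theorem ENNReal.rpow_antitone_of_nonpos {z : ℝ} (hz : z ≤ 0) :
    Antitone fun x : ℝ≥0∞ => x ^ z := fun x y hxy => by
  simpa only [ENNReal.rpow_neg, inv_inv, neg_neg, ENNReal.inv_le_inv] using
    ENNReal.inv_le_inv.2 (ENNReal.rpow_le_rpow hxy (neg_nonneg.2 hz))

section hullFunctional

variable {n : ℕ} {X y z : Fin n → ℝ} {x β : ℝ}

/-- The primal functional in terms of the values at the data points. -/
noncomputable def hullFunctional (X : Fin n → ℝ) (β : ℝ) (y : Fin n → ℝ) : ℝ≥0∞ :=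
  ENNReal.ofReal (vecMean y) +
    ENNReal.ofReal (1 / |β|) * ∫⁻ x in dataHull X, ENNReal.ofReal (lowerHull X y x) ^ β

/-- `y` minimizes `hullFunctional X β` over the nonnegative vectors. -/
structure IsHullMinimizer (X : Fin n → ℝ) (β : ℝ) (y : Fin n → ℝ) : Prop where
  nonneg : ∀ i, 0 ≤ y i
  ne_top : hullFunctional X β y ≠ ∞
  le : ∀ z : Fin n → ℝ, (∀ i, 0 ≤ z i) → hullFunctional X β y ≤ hullFunctional X β z

theorem measurableSet_dataHull (X : Fin n → ℝ) : MeasurableSet (dataHull X) :=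
  (isCompact_dataHull X).measurableSet

theorem volume_dataHull_ne_top (X : Fin n → ℝ) : volume (dataHull X) ≠ ∞ :=
  (isCompact_dataHull X).measure_lt_top.ne

theorem aemeasurable_lowerHull_rpow (hX : (interior (dataHull X)).Nonempty) (y : Fin n → ℝ)
    (β : ℝ) :
    AEMeasurable (fun x => ENNReal.ofReal (lowerHull X y x) ^ β)
      (volume.restrict (dataHull X)) :=
  ((continuousOn_lowerHull hX y).aemeasurable (measurableSet_dataHull X)).ennreal_ofReal.pow_const β

theorem continuous_lowerHull_left (hx : x ∈ dataHull X) :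
    Continuous fun y : Fin n → ℝ => lowerHull X y x := by
  refine (LipschitzWith.of_dist_le_mul (K := 1) fun y z => ?_).continuous
  rw [Real.dist_eq, dist_eq_norm, NNReal.coe_one, one_mul]
  exact abs_lowerHull_sub_le hx

theorem continuous_vecMean : Continuous fun y : Fin n → ℝ => vecMean y := by
  unfold vecMean; fun_prop

/-- Fatou's lemma, since the integrand is continuous in `y` at each point of the hull. -/
theorem lowerSemicontinuous_hullFunctional (hX : (interior (dataHull X)).Nonempty) (β : ℝ) :
    LowerSemicontinuous (hullFunctional X β) := by
  refine LowerSemicontinuous.add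
    (ENNReal.continuous_ofReal.comp continuous_vecMean).lowerSemicontinuous ?_
  rw [lowerSemicontinuous_iff_le_liminf]
  intro y
  simp_rw [← lintegral_const_mul' _ _ (ENNReal.ofReal_ne_top (r := 1 / |β|))]
  refine le_trans ?_ (lintegral_liminf_le' fun y =>
    (aemeasurable_lowerHull_rpow hX y β).const_mul _)
  refine setLIntegral_mono' (measurableSet_dataHull X) fun x hx => ?_
  have hcont : Continuous fun y : Fin n → ℝ =>
      ENNReal.ofReal (1 / |β|) * ENNReal.ofReal (lowerHull X y x) ^ β :=
    (ENNReal.continuous_const_mul ENNReal.ofReal_ne_top).comp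
    (ENNReal.continuous_rpow_const.comp
      (ENNReal.continuous_ofReal.comp (continuous_lowerHull_left hx)))
  exact (hcont.tendsto y).liminf_eq.ge

theorem hullFunctional_one_ne_top (X : Fin n → ℝ) (β : ℝ) :
    hullFunctional X β (fun _ => 1) ≠ ∞ := by
  refine ENNReal.add_ne_top.2 ⟨ENNReal.ofReal_ne_top,
    ENNReal.mul_ne_top ENNReal.ofReal_ne_top ?_⟩
  rw [setLIntegral_congr_fun (g := fun _ => 1) (measurableSet_dataHull X)
    (fun x hx => by simp [lowerHull_const hx])]
  simpa using volume_dataHull_ne_top X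

/-- One nonnegative deviation is at most their sum. Thus a lower bound on the entries and an upper
bound on the mean bound every entry. -/
theorem le_mul_vecMean {y : Fin n → ℝ} {m : ℝ} (hm : ∀ i, m ≤ y i) (i : Fin n) :
    y i - m ≤ n * (vecMean y - m) := by
  have hn : (n : ℝ) ≠ 0 := by exact_mod_cast (Fin.pos i).ne'
  have h := Finset.single_le_sum (f := fun i => y i - m) (fun j _ => sub_nonneg.2 (hm j))
    (Finset.mem_univ i)
  have h2 : ∑ i, (y i - m) = n * (vecMean y - m) := by
    simp only [vecMean, Finset.sum_sub_distrib, Finset.sum_const, Finset.card_univ,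
      Fintype.card_fin, nsmul_eq_mul]
    field_simp
  exact h.trans_eq h2

theorem exists_isHullMinimizer (hX : (interior (dataHull X)).Nonempty) (β : ℝ) :
    ∃ y, IsHullMinimizer X β y := by
  have hn := pos_of_interior_dataHull_nonempty hX
  have htop := hullFunctional_one_ne_top X β
  -- If a nonnegative vector has an entry above `M`, its mean alone exceeds the value of the
  -- functional at the constant vector 1, so minimizing over the compact box [0, M]^n is enough.
  set M : ℝ := n * (hullFunctional X β (fun _ => 1)).toReal with hM
  have hv1 : vecMean (fun _ : Fin n => (1 : ℝ)) = 1 := by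
    simpa using vecMean_affine hn (fun _ => 0) 0 1
  have h1M : 1 ≤ M := by
    have h2 : ENNReal.ofReal 1 ≤ hullFunctional X β (fun _ => 1) := by
      rw [hullFunctional, hv1]; exact le_self_add
    have h3 := (ENNReal.ofReal_le_iff_le_toReal htop).1 h2
    have h4 : (1 : ℝ) ≤ n := by exact_mod_cast hn
    nlinarith
  have h1K : (Set.Icc (0 : Fin n → ℝ) fun _ => M).Nonempty :=
    ⟨fun _ => 1, fun _ => zero_le_one, fun _ => h1M⟩
  obtain ⟨y, hyK, hy⟩ := ((lowerSemicontinuous_hullFunctional hX β).lowerSemicontinuousOn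
    (Set.Icc 0 fun _ => M)).exists_isMinOn h1K isCompact_Icc
  have hy1 : hullFunctional X β y ≤ hullFunctional X β (fun _ => 1) :=
    hy (show (fun _ => 1) ∈ Set.Icc (0 : Fin n → ℝ) fun _ => M from
      ⟨fun _ => zero_le_one, fun _ => h1M⟩)
  refine ⟨y, hyK.1, ne_top_of_le_ne_top htop hy1, fun z hz => ?_⟩
  by_cases hzK : z ∈ Set.Icc (0 : Fin n → ℝ) fun _ => M
  · exact hy hzK
  · refine hy1.trans ?_
    have : ∃ i, M < z i := by
      by_contra! hcon
      exact hzK ⟨hz, hcon⟩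
    obtain ⟨i, hi⟩ := this
    have h1 := le_mul_vecMean hz i
    rw [sub_zero, sub_zero] at h1
    have h2 : (hullFunctional X β (fun _ => 1)).toReal ≤ vecMean z := by
      have hn' : (0 : ℝ) < n := by exact_mod_cast hn
      exact le_of_mul_le_mul_left ((hi.le.trans h1)) hn'
    calc hullFunctional X β (fun _ => 1)
        = ENNReal.ofReal (hullFunctional X β (fun _ => 1)).toReal :=
          (ENNReal.ofReal_toReal htop).symm
      _ ≤ ENNReal.ofReal (vecMean z) := ENNReal.ofReal_le_ofReal h2
      _ ≤ hullFunctional X β z := le_self_add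

theorem lintegral_rpow_of_mem_convexClass (hβ : β < 0) {g : ℝ → ℝ≥0∞} (hg : g ∈ convexClass X) :
    ∫⁻ x, g x ^ β = ∫⁻ x in dataHull X, g x ^ β := by
  rw [← lintegral_indicator (measurableSet_dataHull X)]
  congr 1
  ext x
  by_cases hx : x ∈ dataHull X
  · simp [hx]
  · simp [hx, hg.2.2 x hx, hβ]

theorem primalFunctional_extHull_le (hX : (interior (dataHull X)).Nonempty) {s : ℝ}
    (hβ : 1 + 1 / s < 0) (hy : ∀ i, 0 ≤ y i) :
    primalFunctional s (empiricalMeasure X) (extHull X y) ≤ hullFunctional X (1 + 1 / s) y := by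
  rw [primalFunctional, hullFunctional,
    lintegral_rpow_of_mem_convexClass hβ (extHull_mem_convexClass hy)]
  refine add_le_add
    (lintegral_empiricalMeasure_extHull_le (pos_of_interior_dataHull_nonempty hX) hy)
    (mul_le_mul_right ?_ _)
  exact (setLIntegral_congr_fun (measurableSet_dataHull X)
    fun x hx => by simp only [extHull_of_mem y hx]).le

theorem le_of_mem_convexClass {g : ℝ → ℝ≥0∞} (hg : g ∈ convexClass X) (u v : ℝ) {p q : ℝ}
    (hp : 0 ≤ p) (hq : 0 ≤ q) (hpq : p + q = 1) :
    g (p * u + q * v) ≤ ENNReal.ofReal p * g u + ENNReal.ofReal q * g v := by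
  have h := hg.1.2
  have := @h u (Set.mem_univ u) v (Set.mem_univ v) p.toNNReal q.toNNReal zero_le zero_le
    (by rw [← Real.toNNReal_add hp hq, hpq, Real.toNNReal_one])
  rwa [NNReal.smul_def, NNReal.smul_def, Real.coe_toNNReal _ hp, Real.coe_toNNReal _ hq] at this

theorem ne_top_of_mem_convexClass {g : ℝ → ℝ≥0∞} (hg : g ∈ convexClass X)
    (h : ∀ i, g (X i) ≠ ∞) (hx : x ∈ dataHull X) : g x ≠ ∞ := by
  have hconv : Convex ℝ {x : ℝ | g x ≠ ∞} := fun u hu v hv p q hp hq hpq =>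
    ne_top_of_le_ne_top (ENNReal.add_ne_top.2 ⟨ENNReal.mul_ne_top ENNReal.ofReal_ne_top hu,
      ENNReal.mul_ne_top ENNReal.ofReal_ne_top hv⟩) (le_of_mem_convexClass hg u v hp hq hpq)
  exact convexHull_min (by rintro _ ⟨i, rfl⟩; exact h i) hconv hx

theorem convexOn_toReal_of_mem_convexClass {g : ℝ → ℝ≥0∞} (hg : g ∈ convexClass X)
    (h : ∀ i, g (X i) ≠ ∞) : ConvexOn ℝ (dataHull X) fun x => (g x).toReal := by
  refine ⟨convex_dataHull X, fun u hu v hv p q hp hq hpq => ?_⟩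
  have h3 := ENNReal.mul_ne_top (ENNReal.ofReal_ne_top (r := p)) (ne_top_of_mem_convexClass hg h hu)
  have h4 := ENNReal.mul_ne_top (ENNReal.ofReal_ne_top (r := q)) (ne_top_of_mem_convexClass hg h hv)
  have h5 := ENNReal.toReal_mono (ENNReal.add_ne_top.2 ⟨h3, h4⟩)
    (le_of_mem_convexClass hg u v hp hq hpq)
  rwa [ENNReal.toReal_add h3 h4, ENNReal.toReal_mul, ENNReal.toReal_mul,
    ENNReal.toReal_ofReal hp, ENNReal.toReal_ofReal hq] at h5

theorem lowerSemicontinuousOn_toReal_of_mem_convexClass {g : ℝ → ℝ≥0∞}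
    (hg : g ∈ convexClass X) (h : ∀ i, g (X i) ≠ ∞) :
    LowerSemicontinuousOn (fun x => (g x).toReal) (dataHull X) := by
  intro u hu c hc
  rcases lt_or_ge c 0 with hc0 | hc0
  · exact Eventually.of_forall fun v => hc0.trans_le ENNReal.toReal_nonneg
  have h1 : ENNReal.ofReal c < g u :=
    (ENNReal.ofReal_lt_iff_lt_toReal hc0 (ne_top_of_mem_convexClass hg h hu)).2 hc
  filter_upwards [mem_nhdsWithin_of_mem_nhds (hg.2.1 u _ h1), self_mem_nhdsWithin] with v hv hvI
  exact (ENNReal.ofReal_lt_iff_lt_toReal hc0 (ne_top_of_mem_convexClass hg h hvI)).1 hv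

theorem le_extHull_of_mem_convexClass {g : ℝ → ℝ≥0∞} (hg : g ∈ convexClass X)
    (h : ∀ i, g (X i) ≠ ∞) (hx : x ∈ dataHull X) :
    g x ≤ ENNReal.ofReal (lowerHull X (fun i => (g (X i)).toReal) x) := by
  rw [← ENNReal.ofReal_toReal (ne_top_of_mem_convexClass hg h hx)]
  exact ENNReal.ofReal_le_ofReal (le_lowerHull_of_convexOn
    (convexOn_toReal_of_mem_convexClass hg h)
    (lowerSemicontinuousOn_toReal_of_mem_convexClass hg h) hx)

/-- A minimizer of the primal problem is the lower hull of its values at the data points, and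
these values minimize `hullFunctional`. -/
theorem exists_isHullMinimizer_of_primal (hX : (interior (dataHull X)).Nonempty) {s : ℝ}
    (hβ : 1 + 1 / s < 0) {g : ℝ → ℝ≥0∞} (hg : g ∈ convexClass X)
    (hmin : ∀ h ∈ convexClass X, primalFunctional s (empiricalMeasure X) g ≤
      primalFunctional s (empiricalMeasure X) h) :
    ∃ y, IsHullMinimizer X (1 + 1 / s) y ∧
      ∀ x ∈ dataHull X, g x = ENNReal.ofReal (lowerHull X y x) := by
  have hn := pos_of_interior_dataHull_nonempty hX
  set β := 1 + 1 / s with hβdef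
  have hle : ∀ z : Fin n → ℝ, (∀ i, 0 ≤ z i) →
      primalFunctional s (empiricalMeasure X) g ≤ hullFunctional X β z := fun z hz =>
    (hmin _ (extHull_mem_convexClass hz)).trans (primalFunctional_extHull_le hX hβ hz)
  have htop : primalFunctional s (empiricalMeasure X) g ≠ ∞ :=
    ne_top_of_le_ne_top (hullFunctional_one_ne_top X β) (hle _ fun _ => zero_le_one)
  have hfin : ∀ i, g (X i) ≠ ∞ := by
    have h1 : ∫⁻ x, g x ∂(empiricalMeasure X) ≠ ∞ := (ENNReal.add_ne_top.1 htop).1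
    rw [lintegral_empiricalMeasure] at h1
    intro i hi
    refine h1 (ENNReal.mul_eq_top.2 (Or.inl ⟨by simp, ENNReal.sum_eq_top.2 ⟨i, by simp, hi⟩⟩))
  set y : Fin n → ℝ := fun i => (g (X i)).toReal with hy
  have hy0 : ∀ i, 0 ≤ y i := fun i => ENNReal.toReal_nonneg
  have hgle : ∀ x ∈ dataHull X, g x ≤ ENNReal.ofReal (lowerHull X y x) := fun x hx =>
    le_extHull_of_mem_convexClass hg hfin hx
  have hpow : ∀ x ∈ dataHull X, ENNReal.ofReal (lowerHull X y x) ^ β ≤ g x ^ β := fun x hx =>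
    ENNReal.rpow_antitone_of_nonpos hβ.le (hgle x hx)
  have hL : primalFunctional s (empiricalMeasure X) g =
      ENNReal.ofReal (vecMean y) + ENNReal.ofReal (1 / |β|) * ∫⁻ x in dataHull X, g x ^ β := by
    rw [primalFunctional, lintegral_rpow_of_mem_convexClass hβ hg,
      lintegral_empiricalMeasure_ofReal hn X hfin]
  have hHL : hullFunctional X β y ≤ primalFunctional s (empiricalMeasure X) g := by
    rw [hL, hullFunctional]
    gcongr _ + _ * ?_
    exact setLIntegral_mono' (measurableSet_dataHull X) hpow
  have hc : ENNReal.ofReal (1 / |β|) ≠ 0 := by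
    simpa using hβ.ne
  -- The empirical terms of `g` and of the hull of its values coincide and cancel. With `hpow` this
  -- forces equality of the integrals, hence equality almost everywhere.
  have heq : ∫⁻ x in dataHull X, g x ^ β ≤
      ∫⁻ x in dataHull X, ENNReal.ofReal (lowerHull X y x) ^ β := by
    have := hle y hy0
    rw [hL, hullFunctional, ENNReal.add_le_add_iff_left ENNReal.ofReal_ne_top,
      ENNReal.mul_le_mul_iff_right hc ENNReal.ofReal_ne_top] at this
    exact this
  refine ⟨y, ⟨hy0, ne_top_of_le_ne_top htop hHL, fun z hz => hHL.trans (hle z hz)⟩, ?_⟩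
  have hfin2 : ∫⁻ x in dataHull X, ENNReal.ofReal (lowerHull X y x) ^ β ≠ ∞ := by
    have := ne_top_of_le_ne_top htop hHL
    rw [hullFunctional, ENNReal.add_ne_top] at this
    exact fun h => this.2 (by rw [h, ENNReal.mul_top hc])
  have hcont := continuousOn_of_convexOn_dataHull hX (convexOn_toReal_of_mem_convexClass hg hfin)
    (lowerSemicontinuousOn_toReal_of_mem_convexClass hg hfin)
  have hae : (fun x => (g x).toReal) =ᵐ[volume.restrict (dataHull X)] lowerHull X y := by
    have h1 := ae_eq_of_ae_le_of_lintegral_le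
      ((ae_restrict_iff' (measurableSet_dataHull X)).2 (ae_of_all _ hpow)) hfin2
      (hg.2.1.measurable.pow_const β).aemeasurable heq
    filter_upwards [h1, ae_restrict_mem (measurableSet_dataHull X)] with x h2 hx
    have h3 : ENNReal.ofReal (lowerHull X y x) = g x := by
      have := congrArg (fun t : ℝ≥0∞ => t ^ β⁻¹) h2
      simpa [ENNReal.rpow_rpow_inv hβ.ne] using this
    rw [← h3, ENNReal.toReal_ofReal (le_lowerHull_of_le hx hy0)]
  -- Almost everywhere equality of continuous functions extends to a set contained in the closure of
  -- its interior.
  have hsub : dataHull X ⊆ closure (interior (dataHull X)) := by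
    obtain ⟨A, B, hAB, hI⟩ := exists_dataHull_eq_Icc hX
    rw [hI, interior_Icc, closure_Ioo hAB.ne]
  have hEq := Measure.eqOn_of_ae_eq hae hcont (continuousOn_lowerHull hX y) hsub
  intro x hx
  rw [← hEq hx, ENNReal.ofReal_toReal (ne_top_of_mem_convexClass hg hfin hx)]

end hullFunctional

/-! ### Positivity of minimizers and the first variation -/

theorem tendsto_setIntegral_of_bounded {s : Set ℝ} (hs : IsCompact s) {F : ℕ → ℝ → ℝ} {f : ℝ → ℝ}
    {K : ℝ} (hF : ∀ j, ContinuousOn (F j) s) (hK : ∀ j, ∀ x ∈ s, |F j x| ≤ K)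
    (hlim : ∀ x ∈ s, Tendsto (fun j => F j x) atTop (𝓝 (f x))) :
    Tendsto (fun j => ∫ x in s, F j x) atTop (𝓝 (∫ x in s, f x)) := by
  refine tendsto_integral_of_dominated_convergence (fun _ => K)
    (fun j => (hF j).aestronglyMeasurable hs.measurableSet)
    (integrableOn_const hs.measure_lt_top.ne) (fun j => ?_) ?_
  · filter_upwards [ae_restrict_mem hs.measurableSet] with x hx using hK j x hx
  · filter_upwards [ae_restrict_mem hs.measurableSet] with x hx using hlim x hx

theorem lintegral_ofReal_rpow {s : Set ℝ} (hs : IsCompact s) {v : ℝ → ℝ} (hv : ContinuousOn v s)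
    (hpos : ∀ x ∈ s, 0 < v x) (β : ℝ) :
    ∫⁻ x in s, ENNReal.ofReal (v x) ^ β = ENNReal.ofReal (∫ x in s, v x ^ β) := by
  rw [ofReal_integral_eq_lintegral_ofReal
    ((hv.rpow_const fun x hx => Or.inl (hpos x hx).ne').integrableOn_compact hs)]
  · exact setLIntegral_congr_fun hs.measurableSet fun x hx =>
      ENNReal.ofReal_rpow_of_pos (hpos x hx)
  · filter_upwards [ae_restrict_mem hs.measurableSet] with x hx
    exact (Real.rpow_pos_of_pos (hpos x hx) β).le

/-- The tangent line inequality for the convex function `v ↦ v ^ β` with `β ≤ 0`. -/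
theorem Real.rpow_add_mul_rpow_sub_one_le {β a b : ℝ} (hβ : β ≤ 0) (ha : 0 < a) (hb : 0 < b) :
    b ^ β + β * b ^ (β - 1) * (a - b) ≤ a ^ β := by
  have h1 : 1 + β * (a / b - 1) ≤ (a / b) ^ β := by
    rw [Real.rpow_def_of_pos (div_pos ha hb)]
    have h2 := Real.log_le_sub_one_of_pos (div_pos ha hb)
    have h3 := Real.add_one_le_exp (Real.log (a / b) * β)
    nlinarith
  have hbp := Real.rpow_pos_of_pos hb β
  rw [Real.div_rpow ha.le hb.le, le_div_iff₀ hbp] at h1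
  rw [Real.rpow_sub_one hb.ne']
  refine le_trans (le_of_eq ?_) h1
  field_simp

section IsHullMinimizer

variable {n : ℕ} {X y z : Fin n → ℝ} {x β : ℝ}

theorem volumeReal_dataHull_pos (hX : (interior (dataHull X)).Nonempty) :
    0 < volume.real (dataHull X) := by
  obtain ⟨A, B, hAB, hI⟩ := exists_dataHull_eq_Icc hX
  rw [hI, Real.volume_real_Icc_of_le hAB.le]
  linarith

/-- A convex function is small on a homothetic copy of its domain around a given point. -/
theorem exists_subset_dataHull (hX : (interior (dataHull X)).Nonempty) {h : ℝ → ℝ}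
    (hc : ConvexOn ℝ (dataHull X) h) {x₀ V τ : ℝ} (hx₀ : x₀ ∈ dataHull X)
    (hV : ∀ x ∈ dataHull X, h x ≤ V) (hτ0 : 0 < τ) (hτ1 : τ ≤ 1) :
    ∃ J ⊆ dataHull X, MeasurableSet J ∧ volume.real J = τ * volume.real (dataHull X) ∧
      ∀ x ∈ J, h x ≤ (1 - τ) * h x₀ + τ * V := by
  obtain ⟨A, B, hAB, hI⟩ := exists_dataHull_eq_Icc hX
  have hrep : ∀ x ∈ Set.Icc (x₀ + τ * (A - x₀)) (x₀ + τ * (B - x₀)),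
      ∃ v ∈ dataHull X, x = (1 - τ) • x₀ + τ • v := by
    intro x hx
    refine ⟨x₀ + (x - x₀) / τ, ?_, ?_⟩
    · rw [hI]
      have h1 : A - x₀ ≤ (x - x₀) / τ := by rw [le_div_iff₀' hτ0]; linarith [hx.1]
      have h2 : (x - x₀) / τ ≤ B - x₀ := by rw [div_le_iff₀' hτ0]; linarith [hx.2]
      constructor <;> linarith
    · simp only [smul_eq_mul]
      field_simp
      ring
  refine ⟨Set.Icc (x₀ + τ * (A - x₀)) (x₀ + τ * (B - x₀)), ?_, measurableSet_Icc, ?_, ?_⟩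
  · intro x hx
    obtain ⟨v, hv, rfl⟩ := hrep x hx
    exact convex_dataHull X hx₀ hv (sub_nonneg.2 hτ1) hτ0.le (by ring)
  · rw [hI, Real.volume_real_Icc_of_le hAB.le, Real.volume_real_Icc_of_le (by nlinarith)]
    ring
  · intro x hx
    obtain ⟨v, hv, rfl⟩ := hrep x hx
    refine (hc.2 hx₀ hv (sub_nonneg.2 hτ1) hτ0.le (by ring)).trans ?_
    simp only [smul_eq_mul]
    linarith [mul_le_mul_of_nonneg_left (hV v hv) hτ0.le]

theorem lowerHull_le_norm (hx : x ∈ dataHull X) (y : Fin n → ℝ) : lowerHull X y x ≤ ‖y‖ :=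
  lowerHull_le_of_le hx fun i => (le_abs_self _).trans (norm_le_pi_norm y i)

theorem IsHullMinimizer.lintegral_ne_top (hβ : β < 0) (hy : IsHullMinimizer X β y) :
    ∫⁻ x in dataHull X, ENNReal.ofReal (lowerHull X y x) ^ β ≠ ∞ := by
  intro h
  apply hy.ne_top
  rw [hullFunctional, h, ENNReal.mul_top (by simpa using hβ.ne), add_top]

/-- If the minimum were nonpositive, convexity would keep the hull below τV on an interval of length
τℓ. The integral would then be at least τ^(1 + β) V^β ℓ, unbounded as τ → 0 because β < -1. -/
theorem IsHullMinimizer.exists_pos_le (hX : (interior (dataHull X)).Nonempty) (hβ : β < -1)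
    (hy : IsHullMinimizer X β y) : ∃ m > 0, ∀ x ∈ dataHull X, m ≤ lowerHull X y x := by
  obtain ⟨x₀, hx₀, hmin⟩ := (isCompact_dataHull X).exists_isMinOn (hX.mono interior_subset)
    (continuousOn_lowerHull hX y)
  refine ⟨lowerHull X y x₀, ?_, fun x hx => hmin hx⟩
  by_contra! h0
  have hL := hy.lintegral_ne_top (by linarith)
  set K := (∫⁻ x in dataHull X, ENNReal.ofReal (lowerHull X y x) ^ β).toReal with hK
  have hK0 : 0 ≤ K := ENNReal.toReal_nonneg
  have hℓ := volumeReal_dataHull_pos hX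
  set ℓ := volume.real (dataHull X) with hℓdef
  set V := ‖y‖ + 1 with hVdef
  have hV : 0 < V := by positivity
  have hVβ := Real.rpow_pos_of_pos hV β
  -- Chosen so that τ^(1 + β) = c turns the lower bound into K + V^β ℓ, which exceeds K.
  set c := K / (V ^ β * ℓ) + 1 with hcdef
  have hc1 : 1 ≤ c := by
    have : 0 ≤ K / (V ^ β * ℓ) := by positivity
    linarith
  have hβ1 : 1 + β < 0 := by linarith
  set τ := c ^ (1 + β)⁻¹ with hτ
  have hτ0 : 0 < τ := Real.rpow_pos_of_pos (by linarith) _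
  have hτ1 : τ ≤ 1 := Real.rpow_le_one_of_one_le_of_nonpos hc1 (inv_nonpos.2 hβ1.le)
  have hτc : τ ^ (1 + β) = c := Real.rpow_inv_rpow (by linarith) hβ1.ne
  obtain ⟨J, hJ, hJm, hJv, hJle⟩ := exists_subset_dataHull hX (convexOn_lowerHull X y) hx₀
    (fun x hx => (lowerHull_le_norm hx y).trans (by linarith : ‖y‖ ≤ V)) hτ0 hτ1
  have h1 : ENNReal.ofReal ((τ * V) ^ β * (τ * ℓ)) ≤ ENNReal.ofReal K := by
    rw [hK, ENNReal.ofReal_toReal hL, ENNReal.ofReal_mul (by positivity), ← hJv,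
      ofReal_measureReal (ne_top_of_le_ne_top (volume_dataHull_ne_top X) (measure_mono hJ)),
      ← setLIntegral_const]
    refine (setLIntegral_mono' hJm fun x hx => ?_).trans (lintegral_mono_set hJ)
    rw [← ENNReal.ofReal_rpow_of_pos (by positivity)]
    refine ENNReal.rpow_antitone_of_nonpos (by linarith) (ENNReal.ofReal_le_ofReal ?_)
    have := hJle x hx
    nlinarith [mul_nonneg (sub_nonneg.2 hτ1) (neg_nonneg.2 h0)]
  have h2 := (ENNReal.ofReal_le_ofReal_iff hK0).1 h1
  have h3 : (τ * V) ^ β * (τ * ℓ) = c * (V ^ β * ℓ) := by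
    rw [← hτc, Real.rpow_add hτ0, Real.rpow_one, Real.mul_rpow hτ0.le hV.le]
    ring
  have h4 : c * (V ^ β * ℓ) = K + V ^ β * ℓ := by
    rw [hcdef]; field_simp
  have : 0 < V ^ β * ℓ := by positivity
  linarith

/-- The hull is not linear in the vector, so a lower bound `k` for its difference quotient replaces
the derivative; since β < 0, using the smaller function only increases the functional. The tangent
line is taken at the perturbed function, so the inequality is exact for each `t`. -/
theorem IsHullMinimizer.integral_le_of_lt (hX : (interior (dataHull X)).Nonempty) (hβ : β < 0)
    (hy : IsHullMinimizer X β y) (hpos : ∀ x ∈ dataHull X, 0 < lowerHull X y x)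
    {k : ℝ → ℝ} (hk : ContinuousOn k (dataHull X)) {t : ℝ} (ht : 0 < t)
    (hz : ∀ i, 0 ≤ y i + t * z i)
    (hkpos : ∀ x ∈ dataHull X, 0 < lowerHull X y x + t * k x)
    (hkle : ∀ x ∈ dataHull X, lowerHull X y x + t * k x ≤ lowerHull X (y + t • z) x) :
    ∫ x in dataHull X, (lowerHull X y x + t * k x) ^ (β - 1) * k x ≤ vecMean z := by
  have hcomp := isCompact_dataHull X
  have hmeas := measurableSet_dataHull X
  have hcont := continuousOn_lowerHull hX y
  have hcontk : ContinuousOn (fun x => lowerHull X y x + t * k x) (dataHull X) :=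
    hcont.add (continuousOn_const.mul hk)
  have hβ0 : 0 < |β| := abs_pos.2 hβ.ne
  have hmz : vecMean (y + t • z) = vecMean y + t * vecMean z := by
    rw [vecMean_add]
    simp only [vecMean, Pi.smul_apply, smul_eq_mul, ← Finset.mul_sum]
    ring
  have hvm : ∀ w : Fin n → ℝ, (∀ i, 0 ≤ w i) → 0 ≤ vecMean w := fun w hw =>
    mul_nonneg (by positivity) (Finset.sum_nonneg fun i _ => hw i)
  have hS : ∀ v : ℝ → ℝ, (∀ x ∈ dataHull X, 0 < v x) → 0 ≤ ∫ x in dataHull X, v x ^ β :=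
    fun v hv => setIntegral_nonneg hmeas fun x hx => (Real.rpow_pos_of_pos (hv x hx) β).le
  have h1 : hullFunctional X β y ≤ ENNReal.ofReal (vecMean (y + t • z)) +
      ENNReal.ofReal (1 / |β|) *
        ∫⁻ x in dataHull X, ENNReal.ofReal (lowerHull X y x + t * k x) ^ β := by
    refine (hy.le (y + t • z) hz).trans ?_
    rw [hullFunctional]
    gcongr _ + _ * ?_
    exact setLIntegral_mono' hmeas fun x hx => ENNReal.rpow_antitone_of_nonpos hβ.le
      (ENNReal.ofReal_le_ofReal (hkle x hx))
  rw [hullFunctional, lintegral_ofReal_rpow hcomp hcont hpos,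
    lintegral_ofReal_rpow hcomp hcontk hkpos, ← ENNReal.ofReal_mul (by positivity),
    ← ENNReal.ofReal_mul (by positivity),
    ← ENNReal.ofReal_add (hvm y hy.nonneg) (mul_nonneg (by positivity) (hS _ hpos)),
    ← ENNReal.ofReal_add (hvm (y + t • z) hz) (mul_nonneg (by positivity) (hS _ hkpos)),
    ENNReal.ofReal_le_ofReal_iff
      (add_nonneg (hvm (y + t • z) hz) (mul_nonneg (by positivity) (hS _ hkpos))), hmz] at h1
  have hi : ∀ v : ℝ → ℝ, ContinuousOn v (dataHull X) → (∀ x ∈ dataHull X, 0 < v x) → ∀ p : ℝ,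
      ContinuousOn (fun x => v x ^ p) (dataHull X) := fun v hv hvp p =>
    hv.rpow_const fun x hx => Or.inl (hvp x hx).ne'
  have hi1 := (hi _ hcont hpos β).integrableOn_compact hcomp (μ := volume)
  have hi2 := (hi _ hcontk hkpos β).integrableOn_compact hcomp (μ := volume)
  have hi3 := ((hi _ hcontk hkpos (β - 1)).mul hk).integrableOn_compact hcomp (μ := volume)
  have h2 : |β| * t * ∫ x in dataHull X, (lowerHull X y x + t * k x) ^ (β - 1) * k x ≤
      (∫ x in dataHull X, lowerHull X y x ^ β) -
        ∫ x in dataHull X, (lowerHull X y x + t * k x) ^ β := by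
    rw [← integral_sub hi1 hi2, ← integral_const_mul]
    refine setIntegral_mono_on (hi3.const_mul _) (hi1.sub hi2) hmeas fun x hx => ?_
    have := Real.rpow_add_mul_rpow_sub_one_le hβ.le (hpos x hx) (hkpos x hx)
    rw [abs_of_neg hβ]
    linarith
  have h3 := mul_le_mul_of_nonneg_left h2 (one_div_pos.2 hβ0).le
  have h4 : 1 / |β| * (|β| * t * ∫ x in dataHull X,
      (lowerHull X y x + t * k x) ^ (β - 1) * k x) =
      t * ∫ x in dataHull X, (lowerHull X y x + t * k x) ^ (β - 1) * k x := by
    field_simp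
  rw [h4, mul_sub] at h3
  exact le_of_mul_le_mul_left (by linarith) ht

/-- The first order condition for a minimizer in the direction `z`. -/
theorem IsHullMinimizer.integral_le (hX : (interior (dataHull X)).Nonempty) (hβ : β < -1)
    (hy : IsHullMinimizer X β y) {k : ℝ → ℝ} (hk : ContinuousOn k (dataHull X))
    (hkle : ∀ t ∈ Set.Ioo (0 : ℝ) 1, ∀ x ∈ dataHull X,
      lowerHull X y x + t * k x ≤ lowerHull X (y + t • z) x) :
    ∫ x in dataHull X, lowerHull X y x ^ (β - 1) * k x ≤ vecMean z := by
  obtain ⟨m, hm0, hm⟩ := hy.exists_pos_le hX hβ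
  obtain ⟨K, hK⟩ := (isCompact_dataHull X).exists_bound_of_continuousOn hk
  have hK0 : 0 ≤ K := (norm_nonneg _).trans (hK _ (hX.mono interior_subset).some_mem)
  -- For t ≤ δ the perturbed function stays above m / 2 and the perturbed vector stays nonnegative;
  -- δ < 1 meets the range in `hkle`.
  set δ := min (1 / 2) (m / (2 * (K + ‖z‖ + 1))) with hδ
  have hD : 0 < 2 * (K + ‖z‖ + 1) := by positivity
  have hδ0 : 0 < δ := lt_min (by norm_num) (by positivity)
  have hδ1 : δ < 1 := (min_le_left _ _).trans_lt (by norm_num)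
  have hδm : δ * (2 * (K + ‖z‖ + 1)) ≤ m := by
    rw [← le_div_iff₀ hD]; exact min_le_right _ _
  have hlow : ∀ t, 0 < t → t ≤ δ → ∀ x ∈ dataHull X, m / 2 ≤ lowerHull X y x + t * k x := by
    intro t ht htδ x hx
    have h1 := hK x hx
    rw [Real.norm_eq_abs] at h1
    have h2 : -(t * K) ≤ t * k x := by nlinarith [neg_abs_le (k x)]
    have h3 : t * K ≤ δ * K := mul_le_mul_of_nonneg_right htδ hK0
    have h4 : 0 ≤ δ * (‖z‖ + 1) := by positivity
    nlinarith [hm x hx]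
  have hpos : ∀ x ∈ dataHull X, 0 < lowerHull X y x := fun x hx => hm0.trans_le (hm x hx)
  have hz : ∀ t, 0 < t → t ≤ δ → ∀ i, 0 ≤ y i + t * z i := by
    intro t ht htδ i
    have h1 := (hm _ (mem_dataHull X i)).trans (lowerHull_apply_le X y i)
    have h2 := norm_le_pi_norm z i
    rw [Real.norm_eq_abs] at h2
    have h3 : -(t * ‖z‖) ≤ t * z i := by nlinarith [neg_abs_le (z i)]
    have h4 : t * ‖z‖ ≤ δ * ‖z‖ := mul_le_mul_of_nonneg_right htδ (norm_nonneg z)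
    have h5 : 0 ≤ δ * (K + 1) := by positivity
    have h6 : 0 ≤ δ * ‖z‖ := by positivity
    nlinarith
  set t : ℕ → ℝ := fun j => δ / ((j : ℝ) + 1) with ht
  have ht0 : ∀ j, 0 < t j := fun j => by positivity
  have htδ : ∀ j, t j ≤ δ := fun j =>
    div_le_self hδ0.le (by simp)
  have htlim : Tendsto t atTop (𝓝 0) := by
    simpa [Function.comp_def] using
      (tendsto_const_div_atTop_nhds_zero_nat δ).comp (tendsto_add_atTop_nat 1)
  have hcont := continuousOn_lowerHull hX y
  refine le_of_tendsto (tendsto_setIntegral_of_bounded (isCompact_dataHull X)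
    (F := fun j x => (lowerHull X y x + t j * k x) ^ (β - 1) * k x)
    (K := (m / 2) ^ (β - 1) * K) ?_ ?_ ?_) (Eventually.of_forall fun j => ?_)
  · intro j
    exact ((hcont.add (continuousOn_const.mul hk)).rpow_const fun x hx =>
      Or.inl ((half_pos hm0).trans_le (hlow _ (ht0 j) (htδ j) x hx)).ne').mul hk
  · intro j x hx
    have h1 := hlow _ (ht0 j) (htδ j) x hx
    have h2 := Real.rpow_pos_of_pos ((half_pos hm0).trans_le h1) (β - 1)
    rw [abs_mul, abs_of_pos h2]
    exact mul_le_mul (Real.rpow_le_rpow_of_nonpos (half_pos hm0) h1 (by linarith)) (hK x hx)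
      (abs_nonneg _) (Real.rpow_pos_of_pos (half_pos hm0) _).le
  · intro x hx
    have h1 : Tendsto (fun j => lowerHull X y x + t j * k x) atTop (𝓝 (lowerHull X y x)) := by
      simpa using tendsto_const_nhds.add (htlim.mul_const (k x))
    exact (h1.rpow_const (Or.inl (hpos x hx).ne')).mul_const _
  · exact hy.integral_le_of_lt hX (by linarith) hpos hk (ht0 j) (hz _ (ht0 j) (htδ j))
      (fun x hx => (half_pos hm0).trans_le (hlow _ (ht0 j) (htδ j) x hx))
      (hkle _ ⟨ht0 j, (htδ j).trans_lt hδ1⟩)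

end IsHullMinimizer

/-! ### Critical densities: derivation, uniform bounds and the limit σ → 0 -/

section IsCritical

variable {n : ℕ} {X y w : Fin n → ℝ} {x σ : ℝ} {f : ℝ → ℝ}

/-- The first order conditions for a positive density `f` on `dataHull X` to be optimal, where `f`
is a decreasing function of `lowerHull X w`. -/
structure IsCritical (X w : Fin n → ℝ) (f : ℝ → ℝ) : Prop where
  continuousOn : ContinuousOn f (dataHull X)
  pos : ∀ x ∈ dataHull X, 0 < f x
  integral_le : ∀ z, ∫ x in dataHull X, f x * lowerHull X z x ≤ vecMean z
  integral_eq_one : ∫ x in dataHull X, f x = 1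
  le_integral : vecMean w ≤ ∫ x in dataHull X, f x * lowerHull X w x

/-- The function `(1 + σ u) ^ (-1 / σ)` for `u = lowerHull X w`. -/
noncomputable def renyiDensity (X : Fin n → ℝ) (σ : ℝ) (w : Fin n → ℝ) (x : ℝ) : ℝ :=
  (1 + σ * lowerHull X w x) ^ (-σ⁻¹)

/-- With β = 1 - 1/σ the exponent β - 1 of the first variation equals -1/σ, so under y = 1 + σw the
weight there is the density itself. The bound σ < 1/2 is β < -1. -/
theorem IsHullMinimizer.isCritical (hX : (interior (dataHull X)).Nonempty) (hσ0 : 0 < σ)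
    (hσ1 : σ < 1 / 2) (hy : IsHullMinimizer X (1 + 1 / (-σ)) y) :
    ∃ w, (∀ x ∈ dataHull X, 0 < 1 + σ * lowerHull X w x) ∧
      (∀ x ∈ dataHull X, lowerHull X y x = 1 + σ * lowerHull X w x) ∧
      IsCritical X w (renyiDensity X σ w) := by
  have hn := pos_of_interior_dataHull_nonempty hX
  have hσi : 2 < σ⁻¹ := by
    rw [lt_inv_comm₀ two_pos hσ0]; linarith
  have hβ : 1 + 1 / (-σ) < -1 := by
    rw [one_div, inv_neg]; linarith
  have hβ1 : 1 + 1 / (-σ) - 1 = -σ⁻¹ := by rw [one_div, inv_neg]; ring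
  obtain ⟨m, hm0, hm⟩ := hy.exists_pos_le hX hβ
  set w : Fin n → ℝ := fun i => σ⁻¹ * y i + -σ⁻¹ with hw
  have hwy : ∀ x ∈ dataHull X, lowerHull X w x = σ⁻¹ * lowerHull X y x + -σ⁻¹ := fun x hx =>
    lowerHull_affine hx (inv_pos.2 hσ0) _
  have hyw : ∀ x ∈ dataHull X, lowerHull X y x = 1 + σ * lowerHull X w x := fun x hx => by
    rw [hwy x hx]; field_simp; ring
  have hpos : ∀ x ∈ dataHull X, 0 < 1 + σ * lowerHull X w x := fun x hx => by
    rw [← hyw x hx]; exact hm0.trans_le (hm x hx)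
  have hcont : ContinuousOn (renyiDensity X σ w) (dataHull X) :=
    (continuousOn_const.add (continuousOn_const.mul (continuousOn_lowerHull hX w))).rpow_const
      fun x hx => Or.inl (hpos x hx).ne'
  have hfpos : ∀ x ∈ dataHull X, 0 < renyiDensity X σ w x := fun x hx =>
    Real.rpow_pos_of_pos (hpos x hx) _
  have key : ∀ (z : Fin n → ℝ) (k : ℝ → ℝ), ContinuousOn k (dataHull X) →
      (∀ t ∈ Set.Ioo (0 : ℝ) 1, ∀ x ∈ dataHull X,
        lowerHull X y x + t * k x ≤ lowerHull X (y + t • z) x) →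
      ∫ x in dataHull X, renyiDensity X σ w x * k x ≤ vecMean z := by
    intro z k hk hkle
    refine (setIntegral_congr_fun (measurableSet_dataHull X) fun x hx => ?_).trans_le
      (hy.integral_le hX hβ hk hkle)
    simp only [renyiDensity, hyw x hx, hβ1]
  have hle : ∀ z, ∫ x in dataHull X, renyiDensity X σ w x * lowerHull X z x ≤ vecMean z := by
    refine fun z => key z _ (continuousOn_lowerHull hX z) fun t ht x hx => ?_
    have h1 := le_lowerHull_affine (y := z) hx ht.1 0
    have h2 := lowerHull_add_le (y := y) (z := fun i => t * z i + 0) hx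
    have h3 : (y + fun i => t * z i + 0) = y + t • z := by ext i; simp
    rw [h3] at h2
    linarith
  -- The hull is linear on constants, so the directions 1 and -1 are both available and fix the
  -- mass.
  have hconst : ∀ c : ℝ, (∫ x in dataHull X, renyiDensity X σ w x) * c ≤ c := by
    intro c
    have h1 := hle fun _ => c
    have h2 : vecMean (fun _ : Fin n => c) = c := by
      simpa using vecMean_affine hn (fun _ => 0) 0 c
    rwa [h2, setIntegral_congr_fun (g := fun x => renyiDensity X σ w x * c)
      (measurableSet_dataHull X) (fun x hx => by simp only [lowerHull_const hx]),
      integral_mul_const] at h1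
  have hone : ∫ x in dataHull X, renyiDensity X σ w x = 1 := by
    have h1 := hconst 1
    have h2 := hconst (-1)
    linarith
  have hint : ∀ z, IntegrableOn (fun x => renyiDensity X σ w x * lowerHull X z x) (dataHull X) :=
    fun z => (hcont.mul (continuousOn_lowerHull hX z)).integrableOn_compact (isCompact_dataHull X)
  -- The direction -y is admissible with `k` the negative of the hull, since y - ty = (1 - t)y and
  -- hulls scale under positive factors.
  have hyle : vecMean y ≤ ∫ x in dataHull X, renyiDensity X σ w x * lowerHull X y x := by
    have h1 := key (-y) (fun x => -lowerHull X y x) (continuousOn_lowerHull hX y).neg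
      fun t ht x hx => by
        have h2 := le_lowerHull_affine (y := y) hx (sub_pos.2 ht.2) 0
        have h3 : (fun i => (1 - t) * y i + 0) = y + t • (-y) := by ext i; simp; ring
        rw [h3] at h2
        linarith
    have h2 : vecMean (-y) = -vecMean y := by simp [vecMean]
    simp_rw [mul_neg] at h1
    rw [integral_neg, h2] at h1
    linarith
  refine ⟨w, hpos, hyw, hcont, hfpos, hle, hone, ?_⟩
  have h1 : ∫ x in dataHull X, renyiDensity X σ w x * lowerHull X w x =
      σ⁻¹ * (∫ x in dataHull X, renyiDensity X σ w x * lowerHull X y x) + -σ⁻¹ := by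
    rw [setIntegral_congr_fun (g := fun x => σ⁻¹ * (renyiDensity X σ w x * lowerHull X y x) +
      -σ⁻¹ * renyiDensity X σ w x) (measurableSet_dataHull X)
      (fun x hx => by simp only [hwy x hx]; ring),
      integral_add ((hint y).const_mul _)
        ((hcont.integrableOn_compact (isCompact_dataHull X)).const_mul _),
      integral_const_mul, integral_const_mul, hone, mul_one]
  rw [h1, hw, vecMean_affine hn]
  have := mul_le_mul_of_nonneg_left hyle (inv_pos.2 hσ0).le
  linarith

/-- Bernoulli gives (1 + σu)^(1/σ) ≥ 1 + u for u > 0. Integrated, this bounds the mean of a critical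
vector by the length of the hull. -/
theorem rpow_neg_inv_mul_le_one {σ u : ℝ} (hσ0 : 0 < σ) (hσ1 : σ ≤ 1) (hu : 0 < 1 + σ * u) :
    (1 + σ * u) ^ (-σ⁻¹) * u ≤ 1 := by
  have hp := Real.rpow_pos_of_pos hu (σ⁻¹)
  rcases le_or_gt u 0 with h | h
  · exact (mul_nonpos_of_nonneg_of_nonpos (Real.rpow_pos_of_pos hu _).le h).trans zero_le_one
  · have h1 := one_add_mul_self_le_rpow_one_add (s := σ * u)
      (by nlinarith) ((one_le_inv₀ hσ0).2 hσ1)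
    rw [inv_mul_cancel_left₀ hσ0.ne'] at h1
    rw [Real.rpow_neg hu.le, inv_mul_le_iff₀ hp]
    linarith

theorem exp_neg_le_rpow_neg_inv {σ u : ℝ} (hσ0 : 0 < σ) (hu : 0 < 1 + σ * u) :
    Real.exp (-u) ≤ (1 + σ * u) ^ (-σ⁻¹) := by
  rw [Real.rpow_def_of_pos hu, Real.exp_le_exp]
  have h := Real.log_le_sub_one_of_pos hu
  have h2 : Real.log (1 + σ * u) * σ⁻¹ ≤ u := by
    rw [← div_eq_mul_inv, div_le_iff₀ hσ0]; linarith
  linarith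

/-- The critical vectors are bounded, uniformly in `σ`. -/
theorem exists_bound_of_isCritical (hX : (interior (dataHull X)).Nonempty) :
    ∃ C, 0 < C ∧ ∀ σ w, 0 < σ → σ ≤ 1 → (∀ x ∈ dataHull X, 0 < 1 + σ * lowerHull X w x) →
      IsCritical X w (renyiDensity X σ w) → ‖w‖ ≤ C := by
  have hn : (0 : ℝ) < n := by exact_mod_cast pos_of_interior_dataHull_nonempty hX
  have hn1 : (1 : ℝ) ≤ n := by exact_mod_cast pos_of_interior_dataHull_nonempty hX
  have hℓ := volumeReal_dataHull_pos hX
  set ℓ := volume.real (dataHull X) with hℓdef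
  -- Bound for M = -min u: either M ≤ ℓ, or the mass estimate below gives M ≤ 8n/ℓ.
  set C := ℓ + 8 * n / ℓ with hC
  have hC0 : 0 < C := by positivity
  refine ⟨n * (ℓ + C), by positivity, fun σ w hσ0 hσ1 hpos hc => ?_⟩
  have hmeas := measurableSet_dataHull X
  have hmean : vecMean w ≤ ℓ := by
    refine hc.le_integral.trans ?_
    calc ∫ x in dataHull X, renyiDensity X σ w x * lowerHull X w x
        ≤ ∫ _ in dataHull X, (1 : ℝ) :=
          setIntegral_mono_on ((hc.continuousOn.mul
            (continuousOn_lowerHull hX w)).integrableOn_compact (isCompact_dataHull X))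
            (integrableOn_const (volume_dataHull_ne_top X)) hmeas
            fun x hx => rpow_neg_inv_mul_le_one hσ0 hσ1 (hpos x hx)
      _ = ℓ := by simp [hℓdef]
  obtain ⟨x₀, hx₀, hmin⟩ := (isCompact_dataHull X).exists_isMinOn (hX.mono interior_subset)
    (continuousOn_lowerHull hX w)
  have hmin' : ∀ x ∈ dataHull X, lowerHull X w x₀ ≤ lowerHull X w x := fun x hx => hmin hx
  set M := -lowerHull X w x₀ with hM
  have hMC : M ≤ C := by
    rcases le_total M ℓ with h | h
    · have : 0 ≤ 8 * n / ℓ := by positivity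
      linarith
    have hMw : ∀ i, -M ≤ w i := fun i => by
      rw [hM, neg_neg]
      exact (hmin' _ (mem_dataHull X i)).trans (lowerHull_apply_le X w i)
    -- All entries are at least -M and their mean is at most ℓ, which caps each entry.
    have hV : ∀ x ∈ dataHull X, lowerHull X w x ≤ n * (ℓ + M) - M := fun x hx =>
      lowerHull_le_of_le hx fun i => by
        have h1 := le_mul_vecMean hMw i
        nlinarith
    have hτ0 : (0 : ℝ) < 1 / (4 * n) := by positivity
    obtain ⟨J, hJ, hJm, hJv, hJle⟩ := exists_subset_dataHull hX (convexOn_lowerHull X w) hx₀ hV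
      hτ0 (by rw [div_le_one (by positivity)]; linarith)
    -- The ratio 1/(4n) makes u ≤ -M + (ℓ + M)/4 ≤ -M/2 on `J`, using ℓ ≤ M. The density is at least
    -- exp(-u) ≥ M/2 there, on an interval of length ℓ/(4n).
    have hJ2 : ∀ x ∈ J, M / 2 ≤ renyiDensity X σ w x := by
      intro x hx
      have h1 := hJle x hx
      have h2 : (1 - 1 / (4 * (n : ℝ))) * lowerHull X w x₀ +
          1 / (4 * n) * (n * (ℓ + M) - M) = -M + (ℓ + M) / 4 := by
        rw [show lowerHull X w x₀ = -M by rw [hM, neg_neg]]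
        field_simp
        ring
      have h3 := exp_neg_le_rpow_neg_inv hσ0 (hpos x (hJ hx))
      have h4 := Real.add_one_le_exp (-lowerHull X w x)
      unfold renyiDensity
      linarith
    have hint := hc.continuousOn.integrableOn_compact (isCompact_dataHull X) (μ := volume)
    have h5 : 1 / (4 * n) * ℓ * (M / 2) ≤ 1 := by
      calc 1 / (4 * n) * ℓ * (M / 2) = ∫ _ in J, M / 2 := by
            rw [setIntegral_const, hJv, smul_eq_mul]
        _ ≤ ∫ x in J, renyiDensity X σ w x := setIntegral_mono_on
            (integrableOn_const (ne_top_of_le_ne_top (volume_dataHull_ne_top X)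
              (measure_mono hJ))) (hint.mono_set hJ) hJm hJ2
        _ ≤ ∫ x in dataHull X, renyiDensity X σ w x := setIntegral_mono_set hint
            ((ae_restrict_mem hmeas).mono fun x hx => (hc.pos x hx).le) hJ.eventuallyLE
        _ = 1 := hc.integral_eq_one
    have h6 : M ≤ 8 * n / ℓ := by
      rw [le_div_iff₀ hℓ]
      field_simp at h5
      linarith
    linarith
  have hCw : ∀ i, -C ≤ w i := fun i => by
    have := (hmin' _ (mem_dataHull X i)).trans (lowerHull_apply_le X w i)
    linarith
  refine (pi_norm_le_iff_of_nonneg (by positivity)).2 fun i => ?_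
  have h1 := le_mul_vecMean hCw i
  have h2 := hCw i
  rw [Real.norm_eq_abs, abs_le]
  constructor <;> nlinarith

theorem abs_exp_neg_sub_exp_neg_le {a b K : ℝ} (ha : -K ≤ a) (hb : -K ≤ b) :
    |Real.exp (-a) - Real.exp (-b)| ≤ Real.exp K * |a - b| := by
  have key : ∀ a b : ℝ, -K ≤ a → Real.exp (-a) - Real.exp (-b) ≤ Real.exp K * |a - b| := by
    intro a b ha
    have h1 : Real.exp (-b) = Real.exp (-a) * Real.exp (a - b) := by
      rw [← Real.exp_add]; ring_nf
    have h2 := Real.add_one_le_exp (a - b)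
    have h3 : Real.exp (-a) ≤ Real.exp K := Real.exp_le_exp.2 (by linarith)
    have h4 := neg_abs_le (a - b)
    calc Real.exp (-a) - Real.exp (-b) = Real.exp (-a) * (1 - Real.exp (a - b)) := by
          rw [h1]; ring
      _ ≤ Real.exp (-a) * |a - b| :=
          mul_le_mul_of_nonneg_left (by linarith) (Real.exp_pos _).le
      _ ≤ Real.exp K * |a - b| := mul_le_mul_of_nonneg_right h3 (abs_nonneg _)
  rw [abs_le]
  have h1 := key a b ha
  have h2 := key b a hb
  rw [abs_sub_comm] at h2
  constructor <;> linarith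

/-- The power is exp(-q) with q = log(1 + σu)/σ, and u - 2σC² ≤ q ≤ u. The exponential is Lipschitz
on the range in question. -/
theorem abs_rpow_neg_inv_sub_exp_le {σ u v C : ℝ} (hσ0 : 0 < σ) (hσC : σ * C ≤ 1 / 2)
    (hu : |u| ≤ C) (hv : |v| ≤ C) :
    |(1 + σ * u) ^ (-σ⁻¹) - Real.exp (-v)| ≤
      Real.exp (2 * C) * (2 * σ * C ^ 2 + |u - v|) := by
  have hC0 : 0 ≤ C := (abs_nonneg u).trans hu
  obtain ⟨hu1, hu2⟩ := abs_le.1 hu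
  have hv1 := (abs_le.1 hv).1
  have hs : -(1 / 2) ≤ σ * u := by nlinarith
  have hpos : 0 < 1 + σ * u := by linarith
  set q := Real.log (1 + σ * u) * σ⁻¹ with hq
  have hσq : Real.log (1 + σ * u) = σ * q := by rw [hq]; field_simp
  have hqu : q ≤ u := by
    have := Real.log_le_sub_one_of_pos hpos
    rw [hσq] at this
    exact le_of_mul_le_mul_left (by linarith) hσ0
  have huq : u - 2 * σ * C ^ 2 ≤ q := by
    have h1 := Real.one_sub_inv_le_log_of_pos hpos
    -- For s = σu the difference of the two sides is s²(1 + 2s)/(1 + s), nonnegative since s ≥ -1/2.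
    have h2 : σ * u - 2 * (σ * u) ^ 2 ≤ 1 - (1 + σ * u)⁻¹ := by
      have h3 : 1 - (1 + σ * u)⁻¹ = σ * u / (1 + σ * u) := by field_simp; ring
      rw [h3, le_div_iff₀ hpos]
      nlinarith [mul_nonneg (sq_nonneg (σ * u)) (by linarith : 0 ≤ 1 + 2 * (σ * u))]
    have h4 : u ^ 2 ≤ C ^ 2 := sq_le_sq' hu1 hu2
    have h5 : σ * (u - 2 * σ * C ^ 2) ≤ σ * q := by
      have : σ ^ 2 * u ^ 2 ≤ σ ^ 2 * C ^ 2 := mul_le_mul_of_nonneg_left h4 (sq_nonneg σ)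
      nlinarith
    exact le_of_mul_le_mul_left h5 hσ0
  -- Hence q ≥ -2C, the source of the factor exp(2C).
  have hsmall : 2 * σ * C ^ 2 ≤ C := by nlinarith
  have hf : (1 + σ * u) ^ (-σ⁻¹) = Real.exp (-q) := by
    rw [Real.rpow_def_of_pos hpos, hq, mul_neg]
  rw [hf]
  refine (abs_exp_neg_sub_exp_neg_le (K := 2 * C) (by linarith) (by linarith)).trans
    (mul_le_mul_of_nonneg_left ?_ (Real.exp_pos _).le)
  have h1 : |q - u| ≤ 2 * σ * C ^ 2 := by rw [abs_le]; constructor <;> linarith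
  exact (abs_sub_le q u v).trans (by linarith)

theorem abs_lowerHull_le_norm (hx : x ∈ dataHull X) (w : Fin n → ℝ) : |lowerHull X w x| ≤ ‖w‖ := by
  have h := abs_lowerHull_sub_le (y := w) (z := 0) hx
  have h0 : lowerHull X 0 x = 0 := lowerHull_const hx 0
  rwa [h0, sub_zero, sub_zero] at h

theorem abs_renyiDensity_sub_exp_le {C : ℝ} {w' : Fin n → ℝ} (hσ0 : 0 < σ)
    (hσC : σ * C ≤ 1 / 2) (hw : ‖w‖ ≤ C) (hw' : ‖w'‖ ≤ C) (hx : x ∈ dataHull X) :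
    |renyiDensity X σ w x - Real.exp (-lowerHull X w' x)| ≤
      Real.exp (2 * C) * (2 * σ * C ^ 2 + ‖w - w'‖) :=
  (abs_rpow_neg_inv_sub_exp_le hσ0 hσC ((abs_lowerHull_le_norm hx w).trans hw)
    ((abs_lowerHull_le_norm hx w').trans hw')).trans (mul_le_mul_of_nonneg_left
      (by linarith [abs_lowerHull_sub_le (y := w) (z := w') hx]) (Real.exp_pos _).le)

/-- The first order conditions are preserved in the limit `σ → 0`. -/
theorem IsCritical.of_tendsto (hX : (interior (dataHull X)).Nonempty) {σ : ℕ → ℝ}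
    {w : ℕ → Fin n → ℝ} {w' : Fin n → ℝ} {C : ℝ} (hσ0 : ∀ k, 0 < σ k)
    (hσC : ∀ k, σ k * C ≤ 1 / 2) (hσ : Tendsto σ atTop (𝓝 0)) (hwC : ∀ k, ‖w k‖ ≤ C)
    (hw : Tendsto w atTop (𝓝 w'))
    (hc : ∀ k, IsCritical X (w k) (renyiDensity X (σ k) (w k))) :
    IsCritical X w' fun x => Real.exp (-lowerHull X w' x) := by
  have hcomp := isCompact_dataHull X
  have hC0 : 0 ≤ C := (norm_nonneg _).trans (hwC 0)
  have hw'C : ‖w'‖ ≤ C := le_of_tendsto hw.norm (Eventually.of_forall hwC)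
  have hbound : Tendsto (fun k => Real.exp (2 * C) * (2 * σ k * C ^ 2 + ‖w k - w'‖)) atTop
      (𝓝 0) := by
    have h1 := tendsto_iff_norm_sub_tendsto_zero.1 hw
    simpa using (((hσ.const_mul 2).mul_const (C ^ 2)).add h1).const_mul (Real.exp (2 * C))
  have hlim : ∀ x ∈ dataHull X, Tendsto (fun k => renyiDensity X (σ k) (w k) x) atTop
      (𝓝 (Real.exp (-lowerHull X w' x))) := fun x hx => by
    rw [tendsto_iff_norm_sub_tendsto_zero]
    exact squeeze_zero (fun _ => norm_nonneg _)
      (fun k => abs_renyiDensity_sub_exp_le (hσ0 k) (hσC k) (hwC k) hw'C hx) hbound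
  obtain ⟨D, hD⟩ := hbound.bddAbove_range
  have hbd : ∀ k, ∀ x ∈ dataHull X, |renyiDensity X (σ k) (w k) x| ≤ Real.exp C + D := by
    intro k x hx
    have h1 := (abs_renyiDensity_sub_exp_le (hσ0 k) (hσC k) (hwC k) hw'C hx).trans
      (hD ⟨k, rfl⟩)
    have h2 : |Real.exp (-lowerHull X w' x)| ≤ Real.exp C := by
      rw [abs_of_pos (Real.exp_pos _), Real.exp_le_exp]
      linarith [(abs_le.1 ((abs_lowerHull_le_norm hx w').trans hw'C)).1]
    have h3 := abs_sub_abs_le_abs_sub (renyiDensity X (σ k) (w k) x)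
      (Real.exp (-lowerHull X w' x))
    linarith
  -- The test vectors may vary with k because the last condition is tested on `w k` itself.
  have hint : ∀ (z : ℕ → Fin n → ℝ) (z' : Fin n → ℝ) (Z : ℝ), (∀ k, ‖z k‖ ≤ Z) →
      Tendsto z atTop (𝓝 z') →
      Tendsto (fun k => ∫ x in dataHull X, renyiDensity X (σ k) (w k) x * lowerHull X (z k) x)
        atTop (𝓝 (∫ x in dataHull X, Real.exp (-lowerHull X w' x) * lowerHull X z' x)) := by
    intro z z' Z hZ hz
    refine tendsto_setIntegral_of_bounded hcomp (K := (Real.exp C + D) * Z)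
      (fun k => (hc k).continuousOn.mul (continuousOn_lowerHull hX _)) (fun k x hx => ?_)
      (fun x hx => (hlim x hx).mul (((continuous_lowerHull_left hx).tendsto z').comp hz))
    rw [abs_mul]
    exact mul_le_mul (hbd k x hx) ((abs_lowerHull_le_norm hx _).trans (hZ k)) (abs_nonneg _)
      ((abs_nonneg _).trans (hbd k x hx))
  refine ⟨Real.continuous_exp.comp_continuousOn (continuousOn_lowerHull hX w').neg,
    fun x _ => Real.exp_pos _, fun z => ?_, ?_, ?_⟩
  · exact le_of_tendsto (hint (fun _ => z) z ‖z‖ (fun _ => le_rfl) tendsto_const_nhds)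
      (Eventually.of_forall fun k => (hc k).integral_le z)
  · refine tendsto_nhds_unique (tendsto_setIntegral_of_bounded hcomp
      (fun k => (hc k).continuousOn) hbd hlim) ?_
    simp_rw [fun k => (hc k).integral_eq_one]
    exact tendsto_const_nhds
  · exact le_of_tendsto_of_tendsto ((continuous_vecMean.tendsto w').comp hw)
      (hint w w' C hwC hw) (Eventually.of_forall fun k => (hc k).le_integral)

end IsCritical

/-! ### Identification of the estimators with critical densities -/

/-- The pointwise Gibbs inequality. -/
theorem Real.mul_log_sub_nonneg {p q : ℝ} (hp : 0 ≤ p) (hq : 0 < q) :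
    0 ≤ p * Real.log p - p * Real.log q - p + q := by
  rcases hp.eq_or_lt with rfl | hp
  · simpa using hq.le
  have h := Real.log_le_sub_one_of_pos (div_pos hq hp)
  rw [Real.log_div hq.ne' hp.ne'] at h
  have h2 := mul_le_mul_of_nonneg_left h hp.le
  have h3 : p * (q / p - 1) = q - p := by field_simp
  linarith

theorem Real.eq_of_mul_log_sub_eq_zero {p q : ℝ} (hp : 0 ≤ p) (hq : 0 < q)
    (h0 : p * Real.log p - p * Real.log q - p + q = 0) : p = q := by
  rcases hp.eq_or_lt with rfl | hp
  · simp only [zero_mul, sub_zero, zero_add] at h0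
    exact h0.symm
  by_contra hne
  have h := Real.log_lt_sub_one_of_pos (div_pos hq hp)
    (fun h => hne ((div_eq_one_iff_eq hp.ne').1 h).symm)
  rw [Real.log_div hq.ne' hp.ne'] at h
  have h2 := mul_lt_mul_of_pos_left h hp
  have h3 : p * (q / p - 1) = q - p := by field_simp
  linarith

theorem setIntegral_add_sub {s : Set ℝ} {a b c : ℝ → ℝ} (ha : IntegrableOn a s)
    (hb : IntegrableOn b s) (hc : IntegrableOn c s) :
    ∫ x in s, (a x + b x - c x) =
      (∫ x in s, a x) + (∫ x in s, b x) - ∫ x in s, c x := by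
  have hab : IntegrableOn (fun x => a x + b x) s := ha.add hb
  rw [integral_sub hab hc, integral_add ha hb]

section uniqueness

variable {n : ℕ} {X w : Fin n → ℝ} {x σ : ℝ} {f F : ℝ → ℝ}

theorem eq_zero_of_setIntegral_dataHull_nonpos (hX : (interior (dataHull X)).Nonempty) {D : ℝ → ℝ}
    (hD : ContinuousOn D (dataHull X)) (hD0 : ∀ x ∈ dataHull X, 0 ≤ D x)
    (hint : ∫ x in dataHull X, D x ≤ 0) : ∀ x ∈ dataHull X, D x = 0 := by
  have hmeas := measurableSet_dataHull X
  have hnn : 0 ≤ᵐ[volume.restrict (dataHull X)] D :=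
    (ae_restrict_mem hmeas).mono fun x hx => hD0 x hx
  have h0 := le_antisymm hint (setIntegral_nonneg hmeas hD0)
  rw [setIntegral_eq_zero_iff_of_nonneg_ae hnn
    (hD.integrableOn_compact (isCompact_dataHull X))] at h0
  have hsub : dataHull X ⊆ closure (interior (dataHull X)) := by
    obtain ⟨A, B, hAB, hI⟩ := exists_dataHull_eq_Icc hX
    rw [hI, interior_Icc, closure_Ioo hAB.ne]
  exact Measure.eqOn_of_ae_eq h0 hD continuousOn_const hsub

theorem IsCritical.isDensity_indicator (hc : IsCritical X w f) :
    IsDensity ((dataHull X).indicator f) where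
  nonneg x := Set.indicator_nonneg (fun x hx => (hc.pos x hx).le) x
  integrable := (integrable_indicator_iff (measurableSet_dataHull X)).2
    (hc.continuousOn.integrableOn_compact (isCompact_dataHull X))
  integral_eq_one := by
    rw [integral_indicator (measurableSet_dataHull X), hc.integral_eq_one]

/-- If `g` is infinite at a data point the constraint is trivial. Otherwise `g` lies below the hull
of its data values, for which the constraint is the criticality inequality. -/
theorem IsCritical.isDualFeasible (hX : (interior (dataHull X)).Nonempty)
    (hc : IsCritical X w f) : IsDualFeasible X ((dataHull X).indicator f) := by
  refine ⟨hc.isDensity_indicator, fun g hg => ?_⟩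
  have hmeas := measurableSet_dataHull X
  have hn := pos_of_interior_dataHull_nonempty hX
  by_cases hfin : ∀ i, g (X i) ≠ ∞
  swap
  · push Not at hfin
    obtain ⟨i, hi⟩ := hfin
    rw [lintegral_empiricalMeasure, ENNReal.sum_eq_top.2 ⟨i, Finset.mem_univ i, hi⟩,
      ENNReal.mul_top (by simp)]
    exact le_top
  set y : Fin n → ℝ := fun i => (g (X i)).toReal with hy
  have hy0 : ∀ x ∈ dataHull X, 0 ≤ lowerHull X y x := fun x hx =>
    le_lowerHull_of_le hx fun i => ENNReal.toReal_nonneg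
  calc ∫⁻ x, g x * ENNReal.ofReal ((dataHull X).indicator f x)
      = ∫⁻ x in dataHull X, g x * ENNReal.ofReal (f x) := by
        rw [← lintegral_indicator hmeas]
        congr 1 with x
        by_cases hx : x ∈ dataHull X <;> simp [hx]
    _ ≤ ∫⁻ x in dataHull X, ENNReal.ofReal (f x * lowerHull X y x) := by
        refine setLIntegral_mono' hmeas fun x hx => ?_
        rw [mul_comm, ENNReal.ofReal_mul (hc.pos x hx).le]
        gcongr
        exact le_extHull_of_mem_convexClass hg hfin hx
    _ = ENNReal.ofReal (∫ x in dataHull X, f x * lowerHull X y x) :=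
        (ofReal_integral_eq_lintegral_ofReal
          ((hc.continuousOn.mul (continuousOn_lowerHull hX y)).integrableOn_compact
            (isCompact_dataHull X))
          ((ae_restrict_mem hmeas).mono fun x hx =>
            mul_nonneg (hc.pos x hx).le (hy0 x hx))).symm
    _ ≤ ENNReal.ofReal (vecMean y) := ENNReal.ofReal_le_ofReal (hc.integral_le y)
    _ = ∫⁻ x, g x ∂(empiricalMeasure X) := (lintegral_empiricalMeasure_ofReal hn X hfin).symm

theorem IsDualSolution.setIntegral_eq {Φ : (ℝ → ℝ) → EReal} (hF : IsDualSolution X Φ F) :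
    ∫ x in dataHull X, F x = 1 := by
  rw [setIntegral_eq_integral_of_forall_compl_eq_zero fun x hx => hF.eq_zero x hx]
  exact hF.feasible.1.integral_eq_one

theorem IsDualSolution.integral_le {Φ : (ℝ → ℝ) → EReal}
    (hX : (interior (dataHull X)).Nonempty) (hF : IsDualSolution X Φ F) (z : Fin n → ℝ) :
    ∫ x in dataHull X, F x * lowerHull X z x ≤ vecMean z := by
  have hmeas := measurableSet_dataHull X
  have hn := pos_of_interior_dataHull_nonempty hX
  -- The dual constraint tests nonnegative functions only. A shift by ‖z‖ achieves this, and cancels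
  -- because `F` has mass one on the hull.
  set y : Fin n → ℝ := fun i => 1 * z i + ‖z‖ with hy
  have hy0 : ∀ i, 0 ≤ y i := fun i => by
    have := norm_le_pi_norm z i
    rw [Real.norm_eq_abs] at this
    simp only [hy, one_mul]
    linarith [neg_abs_le (z i)]
  have hyz : ∀ x ∈ dataHull X, lowerHull X y x = lowerHull X z x + ‖z‖ := fun x hx => by
    rw [hy, lowerHull_affine hx one_pos, one_mul]
  have hint : ∀ z, IntegrableOn (fun x => F x * lowerHull X z x) (dataHull X) := fun z =>
    (hF.continuousOn.mul (continuousOn_lowerHull hX z)).integrableOn_compact (isCompact_dataHull X)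
  have hmy : vecMean y = vecMean z + ‖z‖ := by rw [hy, vecMean_affine hn, one_mul]
  have h1 : ENNReal.ofReal (∫ x in dataHull X, F x * lowerHull X y x) ≤
      ENNReal.ofReal (vecMean y) := by
    rw [ofReal_integral_eq_lintegral_ofReal (hint y) ((ae_restrict_mem hmeas).mono fun x hx =>
      mul_nonneg (hF.feasible.1.nonneg x) (le_lowerHull_of_le hx hy0))]
    refine le_trans ?_ ((hF.feasible.2 _ (extHull_mem_convexClass hy0)).trans
      (lintegral_empiricalMeasure_extHull_le hn hy0))
    refine le_trans ?_ (setLIntegral_le_lintegral (dataHull X) _)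
    refine setLIntegral_mono' hmeas fun x hx => ?_
    rw [extHull_of_mem y hx, mul_comm, ENNReal.ofReal_mul (le_lowerHull_of_le hx hy0)]
  have hmy0 : 0 ≤ vecMean y :=
    mul_nonneg (by positivity) (Finset.sum_nonneg fun i _ => hy0 i)
  rw [ENNReal.ofReal_le_ofReal_iff hmy0, hmy, setIntegral_congr_fun
    (g := fun x => F x * lowerHull X z x + F x * ‖z‖) hmeas
    (fun x hx => by simp only [hyz x hx]; ring), integral_add (hint z)
      ((hF.continuousOn.integrableOn_compact (isCompact_dataHull X)).mul_const _),
    integral_mul_const, hF.setIntegral_eq] at h1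
  linarith

/-- A solution of the dual problem with index `1 - σ` coincides with the critical density. -/
theorem IsDualSolution.eq_renyiDensity (hX : (interior (dataHull X)).Nonempty) (hσ0 : 0 < σ)
    (hσ1 : σ < 1) (hpos : ∀ x ∈ dataHull X, 0 < 1 + σ * lowerHull X w x)
    (hc : IsCritical X w (renyiDensity X σ w))
    (hF : IsDualSolution X (dualObjective (1 - σ)) F) :
    ∀ x ∈ dataHull X, F x = renyiDensity X σ w x := by
  have hmeas := measurableSet_dataHull X
  have hcomp := isCompact_dataHull X
  set f := renyiDensity X σ w with hf
  have hα0 : 0 < 1 - σ := by linarith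
  have hα1 : 1 - σ < 1 := by linarith
  have hcF : ContinuousOn (fun x => F x ^ (1 - σ)) (dataHull X) :=
    hF.continuousOn.rpow_const fun x _ => Or.inr hα0.le
  have hcf : ContinuousOn (fun x => f x ^ (1 - σ)) (dataHull X) :=
    hc.continuousOn.rpow_const fun x _ => Or.inr hα0.le
  -- This is f^(-σ) = 1 + σu, which makes the derivative of t^α at f affine in u.
  have hfα : ∀ x ∈ dataHull X, f x ^ (1 - σ) = f x * (1 + σ * lowerHull X w x) := by
    intro x hx
    have hp := hpos x hx
    rw [Real.rpow_sub (hc.pos x hx), Real.rpow_one, hf, renyiDensity,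
      ← Real.rpow_mul hp.le, neg_mul, inv_mul_cancel₀ hσ0.ne', Real.rpow_neg_one, div_inv_eq_mul]
  have hpow : ∀ h : ℝ → ℝ, (∀ x ∉ dataHull X, h x = 0) →
      ∫ x, h x ^ (1 - σ) = ∫ x in dataHull X, h x ^ (1 - σ) := fun h hh =>
    (setIntegral_eq_integral_of_forall_compl_eq_zero fun x hx => by
      rw [hh x hx, Real.zero_rpow hα0.ne']).symm
  -- Needed to compare logarithms, since `Real.log 0 = 0`.
  have hFpos : 0 < ∫ x in dataHull X, F x ^ (1 - σ) := by
    by_contra! h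
    have h1 := eq_zero_of_setIntegral_dataHull_nonpos hX hcF
      (fun x _ => Real.rpow_nonneg (hF.feasible.1.nonneg x) _) h
    have h2 := hF.setIntegral_eq
    rw [setIntegral_congr_fun (g := fun _ => (0 : ℝ)) hmeas fun x hx =>
      (Real.rpow_eq_zero (hF.feasible.1.nonneg x) hα0.ne').1 (h1 x hx)] at h2
    simp at h2
  have hle : ∫ x in dataHull X, f x ^ (1 - σ) ≤ ∫ x in dataHull X, F x ^ (1 - σ) := by
    have h1 := hF.minimal _ (hc.isDualFeasible hX)
    rw [dualObjective, dualObjective, EReal.coe_le_coe_iff, hpow F hF.eq_zero,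
      hpow _ (fun x hx => Set.indicator_of_notMem hx f),
      setIntegral_congr_fun (g := fun x => f x ^ (1 - σ)) (f := fun x =>
        (dataHull X).indicator f x ^ (1 - σ)) hmeas
        (fun x hx => by simp only [Set.indicator_of_mem hx])] at h1
    have h2 : 1 / (1 - σ - 1) < 0 := by
      rw [show 1 - σ - 1 = -σ by ring]
      exact one_div_neg.2 (neg_neg_of_pos hσ0)
    by_contra! hlt
    exact absurd h1 (not_le.2 (mul_lt_mul_of_neg_left (Real.log_lt_log hFpos hlt) h2))
  -- The gap between the concave function t^α and its tangent at f, evaluated at F: pointwise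
  -- nonnegative, and zero only if F = f. Its integral is nonpositive by minimality of F (the factor
  -- 1/(α - 1) is negative, so ∫ F^α is maximal) and by ∫ F u ≤ mean(w) ≤ ∫ f u.
  set D : ℝ → ℝ := fun x => f x ^ (1 - σ) +
    (1 - σ) * (F x * (1 + σ * lowerHull X w x) - f x ^ (1 - σ)) - F x ^ (1 - σ) with hD
  have hcg : ContinuousOn (fun x => F x * (1 + σ * lowerHull X w x)) (dataHull X) :=
    hF.continuousOn.mul (continuousOn_const.add
      (continuousOn_const.mul (continuousOn_lowerHull hX w)))
  have hDc : ContinuousOn D (dataHull X) :=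
    (hcf.add (continuousOn_const.mul (hcg.sub hcf))).sub hcF
  have hDt : ∀ x ∈ dataHull X, D x = f x ^ (1 - σ) *
      (1 + (1 - σ) * (F x / f x - 1) - (1 + (F x / f x - 1)) ^ (1 - σ)) := by
    intro x hx
    have hfx := hc.pos x hx
    have hfp := Real.rpow_pos_of_pos hfx (1 - σ)
    rw [add_sub_cancel, Real.div_rpow (hF.feasible.1.nonneg x) hfx.le]
    have h1 : F x * (1 + σ * lowerHull X w x) = f x ^ (1 - σ) * (F x / f x) := by
      rw [hfα x hx]; field_simp
    simp only [hD, h1]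
    field_simp
  have ht : ∀ x ∈ dataHull X, -1 ≤ F x / f x - 1 := fun x hx => by
    have := div_nonneg (hF.feasible.1.nonneg x) (hc.pos x hx).le
    linarith
  have hD0 : ∀ x ∈ dataHull X, 0 ≤ D x := by
    intro x hx
    rw [hDt x hx]
    exact mul_nonneg (Real.rpow_pos_of_pos (hc.pos x hx) _).le (sub_nonneg.2
      (rpow_one_add_le_one_add_mul_self (ht x hx) hα0.le hα1.le))
  have hi := fun {h : ℝ → ℝ} (hh : ContinuousOn h (dataHull X)) =>
    hh.integrableOn_compact hcomp (μ := volume)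
  have hg : ∀ h : ℝ → ℝ, ContinuousOn h (dataHull X) → ∫ x in dataHull X, h x = 1 →
      ∫ x in dataHull X, h x * (1 + σ * lowerHull X w x) =
        1 + σ * ∫ x in dataHull X, h x * lowerHull X w x := by
    intro h hh h1
    have h2 : IntegrableOn (fun x => σ * (h x * lowerHull X w x)) (dataHull X) :=
      (hi (hh.mul (continuousOn_lowerHull hX w))).const_mul σ
    rw [← integral_const_mul]
    nth_rewrite 2 [← h1]
    rw [← integral_add (hi hh) h2]
    exact setIntegral_congr_fun hmeas fun x _ => by ring
  have hDint : ∫ x in dataHull X, D x ≤ 0 := by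
    have h1 : ∫ x in dataHull X, D x = (∫ x in dataHull X, f x ^ (1 - σ)) +
        (1 - σ) * ((∫ x in dataHull X, F x * (1 + σ * lowerHull X w x)) -
          ∫ x in dataHull X, f x ^ (1 - σ)) - ∫ x in dataHull X, F x ^ (1 - σ) := by
      rw [← integral_sub (hi hcg) (hi hcf), ← integral_const_mul]
      exact setIntegral_add_sub (hi hcf) ((hi (hcg.sub hcf)).const_mul _) (hi hcF)
    have h2 : (∫ x in dataHull X, F x * (1 + σ * lowerHull X w x)) ≤
        ∫ x in dataHull X, f x ^ (1 - σ) := by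
      rw [setIntegral_congr_fun hmeas hfα, hg F hF.continuousOn hF.setIntegral_eq,
        hg f hc.continuousOn hc.integral_eq_one]
      have := mul_le_mul_of_nonneg_left ((hF.integral_le hX w).trans hc.le_integral) hσ0.le
      linarith
    have h3 := mul_nonneg hα0.le (sub_nonneg.2 h2)
    rw [h1]
    linarith
  intro x hx
  have h0 := eq_zero_of_setIntegral_dataHull_nonpos hX hDc hD0 hDint x hx
  rw [hDt x hx] at h0
  by_contra hne
  have hne' : F x / f x - 1 ≠ 0 := by
    rw [sub_ne_zero, Ne, div_eq_one_iff_eq (hc.pos x hx).ne']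
    exact hne
  have h1 := rpow_one_add_lt_one_add_mul_self (ht x hx) hne' hα0 hα1
  have h2 := mul_pos (Real.rpow_pos_of_pos (hc.pos x hx) (1 - σ)) (sub_pos.2 h1)
  exact h2.ne' h0

theorem integral_mul_log_exp_neg (u : ℝ → ℝ) (s : Set ℝ) :
    ∫ x in s, Real.exp (-u x) * Real.log (Real.exp (-u x)) =
      -∫ x in s, Real.exp (-u x) * u x := by
  simp only [Real.log_exp, mul_neg, integral_neg]

/-- A solution of the dual problem with index `1` coincides with the critical density. -/
theorem IsDualSolution.eq_exp_neg (hX : (interior (dataHull X)).Nonempty)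
    (hc : IsCritical X w fun x => Real.exp (-lowerHull X w x))
    (hF : IsDualSolution X dualObjectiveOne F) :
    ∀ x ∈ dataHull X, F x = Real.exp (-lowerHull X w x) := by
  have hmeas := measurableSet_dataHull X
  have hcomp := isCompact_dataHull X
  set f : ℝ → ℝ := fun x => Real.exp (-lowerHull X w x) with hf
  have hi := fun {h : ℝ → ℝ} (hh : ContinuousOn h (dataHull X)) =>
    hh.integrableOn_compact hcomp (μ := volume)
  have hcl : ∀ h : ℝ → ℝ, ContinuousOn h (dataHull X) →
      ContinuousOn (fun x => h x * Real.log (h x)) (dataHull X) := fun h hh =>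
    Real.continuous_mul_log.comp_continuousOn hh
  have hobj : ∀ h : ℝ → ℝ, ContinuousOn h (dataHull X) → (∀ x ∉ dataHull X, h x = 0) →
      dualObjectiveOne h = ((∫ x in dataHull X, h x * Real.log (h x) : ℝ) : EReal) := by
    intro h hh hh0
    have h0 : ∀ x ∉ dataHull X, h x * Real.log (h x) = 0 := fun x hx => by simp [hh0 x hx]
    rw [dualObjectiveOne, if_pos ((integrableOn_iff_integrable_of_support_subset
      (Function.support_subset_iff'.2 h0)).1 (hi (hcl h hh))),
      setIntegral_eq_integral_of_forall_compl_eq_zero h0]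
  have hind : ∀ x ∈ dataHull X, (dataHull X).indicator f x = f x := fun x hx =>
    Set.indicator_of_mem hx f
  have hle : ∫ x in dataHull X, F x * Real.log (F x) ≤ -∫ x in dataHull X, f x * lowerHull X w x := by
    have h1 := hF.minimal _ (hc.isDualFeasible hX)
    rwa [hobj F hF.continuousOn hF.eq_zero, hobj _ (hc.continuousOn.congr hind)
      (fun x hx => Set.indicator_of_notMem hx f), EReal.coe_le_coe_iff,
      setIntegral_congr_fun (f := fun x => (dataHull X).indicator f x *
        Real.log ((dataHull X).indicator f x)) (g := fun x => f x * Real.log (f x)) hmeas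
        (fun x hx => by simp only [hind x hx]), hf, integral_mul_log_exp_neg] at h1
  have hcw : ContinuousOn (fun x => F x * lowerHull X w x) (dataHull X) :=
    hF.continuousOn.mul (continuousOn_lowerHull hX w)
  -- The pointwise Gibbs gap of F relative to f; ∫ F u ≤ mean(w) ≤ ∫ f u and the minimality of F
  -- make its integral nonpositive.
  set D : ℝ → ℝ := fun x => F x * Real.log (F x) + F x * lowerHull X w x - (F x - f x) with hD
  have hDe : ∀ x, D x = F x * Real.log (F x) - F x * Real.log (f x) - F x + f x := fun x => by
    simp only [hD, hf, Real.log_exp]; ring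
  have hDint : ∫ x in dataHull X, D x ≤ 0 := by
    have h1 : ∫ x in dataHull X, D x = (∫ x in dataHull X, F x * Real.log (F x)) +
        (∫ x in dataHull X, F x * lowerHull X w x) - (1 - 1) := by
      nth_rewrite 1 [← hF.setIntegral_eq]
      rw [← hc.integral_eq_one, ← integral_sub (hi hF.continuousOn) (hi hc.continuousOn)]
      exact setIntegral_add_sub (hi (hcl F hF.continuousOn)) (hi hcw)
        ((hi hF.continuousOn).sub (hi hc.continuousOn))
    have h2 := (hF.integral_le hX w).trans hc.le_integral
    rw [h1]
    linarith
  intro x hx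
  have hDc : ContinuousOn D (dataHull X) :=
    ((hcl F hF.continuousOn).add hcw).sub (hF.continuousOn.sub hc.continuousOn)
  have h0 := eq_zero_of_setIntegral_dataHull_nonpos hX hDc
    (fun x hx => by
      rw [hDe]; exact Real.mul_log_sub_nonneg (hF.feasible.1.nonneg x) (hc.pos x hx)) hDint x hx
  rw [hDe] at h0
  exact Real.eq_of_mul_log_sub_eq_zero (hF.feasible.1.nonneg x) (hc.pos x hx) h0

theorem isLogConcaveDensity_indicator_exp_neg
    (hc : IsCritical X w fun x => Real.exp (-lowerHull X w x)) :
    IsLogConcaveDensity ((dataHull X).indicator fun x => Real.exp (-lowerHull X w x)) := by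
  set f : ℝ → ℝ := fun x => Real.exp (-lowerHull X w x) with hf
  have hnn := hc.isDensity_indicator.nonneg
  refine ⟨hc.isDensity_indicator, fun x c (hxc : (dataHull X).indicator f x < c) => ?_, fun x y a b ha hb hab => ?_⟩
  · by_cases hx : x ∈ dataHull X
    · rw [Set.indicator_of_mem hx] at hxc
      have h1 := (hc.continuousOn x hx).eventually (gt_mem_nhds hxc)
      rw [eventually_nhdsWithin_iff] at h1
      filter_upwards [h1] with v hv
      show (dataHull X).indicator f v < c
      by_cases hvI : v ∈ dataHull X
      · rw [Set.indicator_of_mem hvI]; exact hv hvI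
      · rw [Set.indicator_of_notMem hvI]; exact (hc.pos x hx).trans hxc
    · rw [Set.indicator_of_notMem hx] at hxc
      filter_upwards [(isCompact_dataHull X).isClosed.isOpen_compl.mem_nhds hx] with v hv
      show (dataHull X).indicator f v < c
      rwa [Set.indicator_of_notMem hv]
  · rcases ha.eq_or_lt with rfl | ha'
    · rw [zero_add] at hab; subst hab; simp
    rcases hb.eq_or_lt with rfl | hb'
    · rw [add_zero] at hab; subst hab; simp
    by_cases hx : x ∈ dataHull X
    swap
    · rw [Set.indicator_of_notMem hx, Real.zero_rpow ha'.ne', zero_mul]; exact hnn _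
    by_cases hy : y ∈ dataHull X
    swap
    · rw [Set.indicator_of_notMem hy, Real.zero_rpow hb'.ne', mul_zero]; exact hnn _
    have hxy : a * x + b * y ∈ dataHull X := convex_dataHull X hx hy ha hb hab
    rw [Set.indicator_of_mem hx, Set.indicator_of_mem hy, Set.indicator_of_mem hxy, hf,
      ← Real.exp_mul, ← Real.exp_mul, ← Real.exp_add, Real.exp_le_exp]
    have := (convexOn_lowerHull X w).2 hx hy ha hb hab
    simp only [smul_eq_mul] at this
    linarith

/-- The log-concave maximum likelihood estimator coincides with the critical density. -/
theorem IsLogConcaveMLE.eq_indicator (hX : (interior (dataHull X)).Nonempty)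
    (hc : IsCritical X w fun x => Real.exp (-lowerHull X w x)) (hF : IsLogConcaveMLE X F) :
    F = (dataHull X).indicator fun x => Real.exp (-lowerHull X w x) := by
  have hmeas := measurableSet_dataHull X
  have hcomp := isCompact_dataHull X
  have hn : (0 : ℝ) < n := by exact_mod_cast pos_of_interior_dataHull_nonempty hX
  set f : ℝ → ℝ := fun x => Real.exp (-lowerHull X w x) with hf
  have hprod := hF.2 _ (isLogConcaveDensity_indicator_exp_neg hc)
  simp only [Set.indicator_of_mem (mem_dataHull X _)] at hprod
  have hprodpos : 0 < ∏ i, f (X i) := Finset.prod_pos fun i _ => Real.exp_pos _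
  have hFX : ∀ i, 0 < F (X i) := fun i => by
    refine (hF.1.nonneg _).lt_of_ne fun h => ?_
    rw [Finset.prod_eq_zero (f := fun i => F (X i)) (Finset.mem_univ i) h.symm] at hprod
    exact hprodpos.not_ge hprod
  -- Log-concavity makes the positivity set convex, and it contains the data, so log F is finite on
  -- the hull.
  have hconv : Convex ℝ {x | 0 < F x} := fun x hx y hy a b ha hb hab =>
    (mul_pos (Real.rpow_pos_of_pos hx a) (Real.rpow_pos_of_pos hy b)).trans_le
      (hF.1.logConcave x y a b ha hb hab)
  have hsub : dataHull X ⊆ {x | 0 < F x} :=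
    convexHull_min (by rintro _ ⟨i, rfl⟩; exact hFX i) hconv
  have hlogconv : ConvexOn ℝ (dataHull X) fun x => -Real.log (F x) := by
    refine ⟨convex_dataHull X, fun x hx y hy a b ha hb hab => ?_⟩
    have h1 := Real.rpow_pos_of_pos (hsub hx) a
    have h2 := Real.rpow_pos_of_pos (hsub hy) b
    have h3 := Real.log_le_log (mul_pos h1 h2) (hF.1.logConcave x y a b ha hb hab)
    rw [Real.log_mul h1.ne' h2.ne', Real.log_rpow (hsub hx), Real.log_rpow (hsub hy)] at h3
    simp only [smul_eq_mul]
    linarith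
  have hloglsc : LowerSemicontinuousOn (fun x => -Real.log (F x)) (dataHull X) := by
    intro x hx c hxc
    have h1 : F x < Real.exp (-c) := by
      rw [← Real.log_lt_iff_lt_exp (hsub hx)]; linarith
    filter_upwards [mem_nhdsWithin_of_mem_nhds (hF.1.usc x _ h1), self_mem_nhdsWithin]
      with v hv hvI
    have := (Real.log_lt_iff_lt_exp (hsub hvI)).2 hv
    linarith
  have hlogc := continuousOn_of_convexOn_dataHull hX hlogconv hloglsc
  have hFc : ContinuousOn F (dataHull X) :=
    (Real.continuous_exp.comp_continuousOn hlogc.neg).congr fun x hx => by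
      simp [Real.exp_log (hsub hx)]
  have hi := fun {h : ℝ → ℝ} (hh : ContinuousOn h (dataHull X)) =>
    hh.integrableOn_compact hcomp (μ := volume)
  have hcφ : ContinuousOn (fun x => f x * -Real.log (F x)) (dataHull X) :=
    hc.continuousOn.mul hlogc
  have hcw : ContinuousOn (fun x => f x * lowerHull X w x) (dataHull X) :=
    hc.continuousOn.mul (continuousOn_lowerHull hX w)
  have hmle : ∫ x in dataHull X, f x * -Real.log (F x) ≤
      ∫ x in dataHull X, f x * lowerHull X w x := by
    -- The convex function -log F lies below the hull of its data values, where criticality applies;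
    -- the likelihood comparison then brings in `w`.
    have h1 : ∫ x in dataHull X, f x * -Real.log (F x) ≤
        vecMean fun i => -Real.log (F (X i)) := by
      refine le_trans ?_ (hc.integral_le _)
      exact setIntegral_mono_on (hi hcφ)
        (hi (hc.continuousOn.mul (continuousOn_lowerHull hX _))) hmeas fun x hx =>
        mul_le_mul_of_nonneg_left (le_lowerHull_of_convexOn hlogconv hloglsc hx) (hc.pos x hx).le
    have h2 : vecMean (fun i => -Real.log (F (X i))) ≤ vecMean w := by
      refine mul_le_mul_of_nonneg_left ?_ (inv_nonneg.2 hn.le)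
      have h3 := Real.log_le_log hprodpos hprod
      rw [Real.log_prod fun i _ => (hFX i).ne', Real.log_prod fun i _ => (Real.exp_pos _).ne'] at h3
      rw [Finset.sum_neg_distrib]
      have h4 : ∑ i, lowerHull X w (X i) ≤ ∑ i, w i :=
        Finset.sum_le_sum fun i _ => lowerHull_apply_le X w i
      simp only [Real.log_exp, Finset.sum_neg_distrib] at h3
      linarith
    exact h1.trans (h2.trans hc.le_integral)
  have hFint : (∫ x in dataHull X, F x) ≤ 1 := by
    rw [← hF.1.integral_eq_one]
    exact setIntegral_le_integral hF.1.integrable (ae_of_all _ hF.1.nonneg)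
  -- The Gibbs gap with the roles exchanged: f relative to F. Here the mass of F on the hull need
  -- only be at most one.
  set D : ℝ → ℝ := fun x => F x + f x * -Real.log (F x) - (f x * lowerHull X w x + f x) with hD
  have hDe : ∀ x, -f x * lowerHull X w x = f x * Real.log (f x) := fun x => by
    simp [hf, Real.log_exp]
  have hDe' : ∀ x, D x = f x * Real.log (f x) - f x * Real.log (F x) - f x + F x := fun x => by
    rw [← hDe]; simp only [hD]; ring
  have hDint : ∫ x in dataHull X, D x ≤ 0 := by
    have h1 : ∫ x in dataHull X, D x = (∫ x in dataHull X, F x) +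
        (∫ x in dataHull X, f x * -Real.log (F x)) -
        ((∫ x in dataHull X, f x * lowerHull X w x) + ∫ x in dataHull X, f x) := by
      rw [← integral_add (hi hcw) (hi hc.continuousOn)]
      exact setIntegral_add_sub (hi hFc) (hi hcφ) ((hi hcw).add (hi hc.continuousOn))
    rw [h1, hc.integral_eq_one]
    linarith
  have hEq : ∀ x ∈ dataHull X, F x = f x := by
    intro x hx
    have hDc : ContinuousOn D (dataHull X) := (hFc.add hcφ).sub (hcw.add hc.continuousOn)
    have h0 := eq_zero_of_setIntegral_dataHull_nonpos hX hDc
      (fun x hx => by rw [hDe']; exact Real.mul_log_sub_nonneg (hc.pos x hx).le (hsub hx))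
      hDint x hx
    rw [hDe'] at h0
    exact (Real.eq_of_mul_log_sub_eq_zero (hc.pos x hx).le (hsub hx) h0).symm
  have hcompl : ∀ᵐ x, x ∈ (dataHull X)ᶜ → F x = 0 := by
    have h1 := integral_add_compl hmeas hF.1.integrable
    rw [hF.1.integral_eq_one, setIntegral_congr_fun hmeas hEq, hc.integral_eq_one] at h1
    have h2 : ∫ x in (dataHull X)ᶜ, F x = 0 := by linarith
    rw [setIntegral_eq_zero_iff_of_nonneg_ae (ae_of_all _ hF.1.nonneg)
      hF.1.integrable.integrableOn] at h2
    exact (ae_restrict_iff' hmeas.compl).1 h2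
  -- The hull already carries all the mass. A positive value outside would make F positive on an
  -- interval between that point and the hull, contradicting `hcompl`.
  have hoff : ∀ x ∉ dataHull X, F x = 0 := by
    intro x hx
    by_contra hne
    have hFx : 0 < F x := (hF.1.nonneg x).lt_of_ne' hne
    have hnull : ∀ a b : ℝ, a < b → Set.Ioo a b ⊆ (dataHull X)ᶜ →
        Set.Ioo a b ⊆ {x | 0 < F x} → False := by
      intro a b hab h1 h2
      have h3 : volume (Set.Ioo a b) = 0 :=
        measure_mono_null (fun v hv (hcon : v ∈ (dataHull X)ᶜ → F v = 0) =>
          (h2 hv).ne' (hcon (h1 hv))) (ae_iff.1 hcompl)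
      rw [Real.volume_Ioo, ENNReal.ofReal_eq_zero] at h3
      linarith
    obtain ⟨A, B, hAB, hI⟩ := exists_dataHull_eq_Icc hX
    have hoc := hconv.ordConnected
    rcases lt_or_ge B x with h | h
    · refine hnull B x h (fun v hv hvI => ?_) (Set.Ioo_subset_Icc_self.trans
        (hoc.out (hsub (hI ▸ Set.right_mem_Icc.2 hAB.le)) hFx))
      rw [hI] at hvI
      exact absurd hvI.2 (not_le.2 hv.1)
    · have hxA : x < A := by
        by_contra! hcon
        exact hx (hI ▸ ⟨hcon, h⟩)
      refine hnull x A hxA (fun v hv hvI => ?_) (Set.Ioo_subset_Icc_self.trans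
        (hoc.out hFx (hsub (hI ▸ Set.left_mem_Icc.2 hAB.le))))
      rw [hI] at hvI
      exact absurd hvI.1 (not_le.2 hv.2)
  ext x
  by_cases hx : x ∈ dataHull X
  · rw [Set.indicator_of_mem hx, hEq x hx]
  · rw [Set.indicator_of_notMem hx, hoff x hx]

end uniqueness

/-! ### Uniform convergence by compactness -/

section convergence

variable {n : ℕ} {X : Fin n → ℝ}

/-- Both versions of the Rényi estimator with index `1 - σ` are critical densities. -/
theorem exists_isCritical_of_estimator (hX : (interior (dataHull X)).Nonempty) {σ : ℝ}
    (hσ0 : 0 < σ) (hσ1 : σ < 1 / 2) {F : ℝ → ℝ}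
    (hF : IsRenyiEstimator X (1 - σ) F ∨ IsDualSolution X (dualObjective (1 - σ)) F) :
    ∃ w, (∀ x ∈ dataHull X, 0 < 1 + σ * lowerHull X w x) ∧
      IsCritical X w (renyiDensity X σ w) ∧ F = (dataHull X).indicator (renyiDensity X σ w) := by
  have hs : 1 - σ - 1 = -σ := by ring
  rcases hF with ⟨g, hg, hmin, hFg⟩ | hF
  · rw [hs] at hmin
    simp_rw [hs] at hFg
    have hβ : 1 + 1 / (-σ) < 0 := by
      have : 1 < σ⁻¹ := by rw [lt_inv_comm₀ one_pos hσ0]; linarith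
      rw [one_div, inv_neg]
      linarith
    obtain ⟨y, hy, hgy⟩ := exists_isHullMinimizer_of_primal hX hβ hg hmin
    obtain ⟨w, hpos, hyw, hc⟩ := hy.isCritical hX hσ0 hσ1
    refine ⟨w, hpos, hc, ?_⟩
    ext x
    rw [hFg x]
    by_cases hx : x ∈ dataHull X
    · rw [Set.indicator_of_mem hx, hgy x hx, hyw x hx, ENNReal.ofReal_rpow_of_pos (hpos x hx),
        ENNReal.toReal_ofReal (Real.rpow_nonneg (hpos x hx).le _), renyiDensity, one_div, inv_neg]
    · rw [Set.indicator_of_notMem hx, hg.2.2 x hx, ENNReal.top_rpow_of_neg, ENNReal.toReal_zero]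
      exact one_div_neg.2 (neg_neg_of_pos hσ0)
  -- A dual solution carries no vector of its own; one is taken from a primal minimizer and matched
  -- by uniqueness.
  · obtain ⟨y, hy⟩ := exists_isHullMinimizer hX (1 + 1 / (-σ))
    obtain ⟨w, hpos, -, hc⟩ := hy.isCritical hX hσ0 hσ1
    refine ⟨w, hpos, hc, ?_⟩
    ext x
    by_cases hx : x ∈ dataHull X
    · rw [Set.indicator_of_mem hx, hF.eq_renyiDensity hX hσ0 (by linarith) hpos hc x hx]
    · rw [Set.indicator_of_notMem hx, hF.eq_zero x hx]

/-- The Rényi estimators converge uniformly to the log-concave maximum likelihood estimator, and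
all of them vanish outside of the convex hull of the data. -/
theorem eventually_abs_sub_le (hX : (interior (dataHull X)).Nonempty)
    {f : ℝ → ℝ → ℝ} {f₁ : ℝ → ℝ}
    (hf : ∀ᶠ α in 𝓝[<] (1 : ℝ),
      IsRenyiEstimator X α (f α) ∨ IsDualSolution X (dualObjective α) (f α))
    (hf₁ : IsLogConcaveMLE X f₁ ∨ IsDualSolution X dualObjectiveOne f₁) {ε : ℝ} (hε : 0 < ε) :
    ∀ᶠ α in 𝓝[<] (1 : ℝ), (∀ x ∈ dataHull X, |f α x - f₁ x| ≤ ε) ∧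
      ∀ x ∉ dataHull X, f α x = f₁ x := by
  obtain ⟨C, hC0, hC⟩ := exists_bound_of_isCritical hX
  by_contra hcon
  have hσlim : Tendsto (fun α : ℝ => 1 - α) (𝓝[<] (1 : ℝ)) (𝓝 0) := by
    have : Tendsto (fun α : ℝ => 1 - α) (𝓝 1) (𝓝 (1 - 1)) :=
      (continuous_const.sub continuous_id).tendsto 1
    rw [sub_self] at this
    exact this.mono_left nhdsWithin_le_nhds
  have hsmall : ∀ᶠ α in 𝓝[<] (1 : ℝ), 1 - α < 1 / 2 ∧ (1 - α) * C ≤ 1 / 2 := by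
    have h1 := hσlim.eventually (gt_mem_nhds (by norm_num : (0 : ℝ) < 1 / 2))
    have h2 := (hσlim.mul_const C).eventually
      (ge_mem_nhds (by norm_num : (0 : ℝ) * C < 1 / 2))
    exact h1.and h2
  -- If the claim failed, it would fail along a sequence tending to 1. The vectors along it are
  -- bounded, and a limit of a subsequence is critical with density exp(-u), which must be f₁.
  obtain ⟨a, ha1, ha⟩ := exists_seq_forall_of_frequently
    ((not_eventually.1 hcon).and_eventually (hf.and (hsmall.and self_mem_nhdsWithin)))
  have hσ0 : ∀ k, 0 < 1 - a k := fun k => sub_pos.2 (ha k).2.2.2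
  have hex : ∀ k, ∃ w, (∀ x ∈ dataHull X, 0 < 1 + (1 - a k) * lowerHull X w x) ∧
      IsCritical X w (renyiDensity X (1 - a k) w) ∧
      f (a k) = (dataHull X).indicator (renyiDensity X (1 - a k) w) := fun k =>
    exists_isCritical_of_estimator hX (hσ0 k) (ha k).2.2.1.1
      (by rw [sub_sub_cancel]; exact (ha k).2.1)
  choose w hpos hc hfw using hex
  have hwC : ∀ k, ‖w k‖ ≤ C := fun k =>
    hC _ _ (hσ0 k) (by linarith [(ha k).2.2.1.1]) (hpos k) (hc k)
  obtain ⟨w', -, φ, hφ, hw'⟩ := (isCompact_closedBall (0 : Fin n → ℝ) C).tendsto_subseq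
    (fun k => by rw [mem_closedBall_zero_iff]; exact hwC k)
  have hσφ : Tendsto (fun k => 1 - a (φ k)) atTop (𝓝 0) :=
    (hσlim.comp ha1).comp hφ.tendsto_atTop
  have hσC : ∀ k, (1 - a (φ k)) * C ≤ 1 / 2 := fun k => (ha (φ k)).2.2.1.2
  have hc' := IsCritical.of_tendsto hX (fun k => hσ0 (φ k)) hσC hσφ (fun k => hwC (φ k)) hw'
    (fun k => hc (φ k))
  have hw'C : ‖w'‖ ≤ C := le_of_tendsto hw'.norm (Eventually.of_forall fun k => hwC (φ k))
  have hf₁' : f₁ = (dataHull X).indicator fun x => Real.exp (-lowerHull X w' x) := by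
    rcases hf₁ with h | h
    · exact h.eq_indicator hX hc'
    · ext x
      by_cases hx : x ∈ dataHull X
      · rw [Set.indicator_of_mem hx, h.eq_exp_neg hX hc' x hx]
      · rw [Set.indicator_of_notMem hx, h.eq_zero x hx]
  have hbound : Tendsto (fun k => Real.exp (2 * C) * (2 * (1 - a (φ k)) * C ^ 2 +
      ‖w (φ k) - w'‖)) atTop (𝓝 0) := by
    have h1 := tendsto_iff_norm_sub_tendsto_zero.1 hw'
    simpa using (((hσφ.const_mul 2).mul_const (C ^ 2)).add h1).const_mul (Real.exp (2 * C))
  obtain ⟨k, hk⟩ := (hbound.eventually (ge_mem_nhds hε)).exists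
  refine (ha (φ k)).1 ⟨fun x hx => ?_, fun x hx => ?_⟩
  · rw [hfw, hf₁', Set.indicator_of_mem hx, Set.indicator_of_mem hx]
    exact (abs_renyiDensity_sub_exp_le (hσ0 _) (hσC k) (hwC _) hw'C hx).trans hk
  · rw [hfw, hf₁', Set.indicator_of_notMem hx, Set.indicator_of_notMem hx]

theorem exists_weight_le (X : Fin n → ℝ) (κ : ℝ) :
    ∃ W, 0 ≤ W ∧ ∀ x ∈ dataHull X, (1 + |x|) ^ κ ≤ W := by
  have hcont : ContinuousOn (fun x : ℝ => (1 + |x|) ^ κ) (dataHull X) :=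
    (continuous_const.add continuous_abs).continuousOn.rpow_const
      fun x _ => Or.inl (by positivity : (0 : ℝ) < 1 + |x|).ne'
  obtain ⟨W, hW⟩ := (isCompact_dataHull X).exists_bound_of_continuousOn hcont
  exact ⟨max W 0, le_max_right _ _, fun x hx =>
    (le_abs_self _).trans ((hW x hx).trans (le_max_left _ _))⟩

end convergence

theorem mainTheorem5 (n : ℕ) (X : Fin n → ℝ) (hX : (interior (dataHull X)).Nonempty)
    (f : ℝ → ℝ → ℝ) (f₁ : ℝ → ℝ)
    (hf : ∀ᶠ α in 𝓝[<] (1 : ℝ),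
      IsRenyiEstimator X α (f α) ∨ IsDualSolution X (dualObjective α) (f α))
    (hf₁ : IsLogConcaveMLE X f₁ ∨ IsDualSolution X dualObjectiveOne f₁) :
    (∀ κ p : ℝ, 0 < κ → 1 ≤ p →
      Tendsto (fun α => ∫⁻ x, ENNReal.ofReal ((1 + |x|) ^ κ * |f α x - f₁ x| ^ p))
        (𝓝[<] (1 : ℝ)) (𝓝 0)) ∧
    (∀ S : Set ℝ, IsClosed S → (∀ x ∈ S, ContinuousAt f₁ x) → ∀ κ : ℝ, 0 < κ →
      Tendsto (fun α => ⨆ x ∈ S, ENNReal.ofReal ((1 + |x|) ^ κ * |f α x - f₁ x|))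
        (𝓝[<] (1 : ℝ)) (𝓝 0)) := by
  refine ⟨fun κ p _ hp => ?_, fun S _ _ κ _ => ?_⟩
  · obtain ⟨W, hW0, hW⟩ := exists_weight_le X κ
    have hp0 : 0 < p := by linarith
    rw [ENNReal.tendsto_nhds_zero]
    intro η hη
    -- An error ε on the hull contributes at most W ε^p times its length; off the hull the integrand
    -- vanishes.
    have hlim : Tendsto (fun ε : ℝ => ENNReal.ofReal (W * ε ^ p) * volume (dataHull X))
        (𝓝[>] 0) (𝓝 0) := by
      have h1 : Continuous fun ε : ℝ => ENNReal.ofReal (W * ε ^ p) * volume (dataHull X) :=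
        (ENNReal.continuous_mul_const (volume_dataHull_ne_top X)).comp
          (ENNReal.continuous_ofReal.comp
            (continuous_const.mul (Real.continuous_rpow_const hp0.le)))
      have h2 := h1.tendsto 0
      simp only [Real.zero_rpow hp0.ne', mul_zero, ENNReal.ofReal_zero, zero_mul] at h2
      exact h2.mono_left nhdsWithin_le_nhds
    obtain ⟨ε, hεη, hε⟩ := ((hlim.eventually (ge_mem_nhds hη)).and self_mem_nhdsWithin).exists
    filter_upwards [eventually_abs_sub_le hX hf hf₁ hε] with α hα
    refine le_trans ?_ hεη
    rw [← setLIntegral_const, ← lintegral_indicator (measurableSet_dataHull X)]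
    refine lintegral_mono fun x => ?_
    by_cases hx : x ∈ dataHull X
    · rw [Set.indicator_of_mem hx]
      exact ENNReal.ofReal_le_ofReal (mul_le_mul (hW x hx)
        (Real.rpow_le_rpow (abs_nonneg _) (hα.1 x hx) hp0.le) (by positivity) hW0)
    · simp [hα.2 x hx, Real.zero_rpow hp0.ne']
  · obtain ⟨W, hW0, hW⟩ := exists_weight_le X κ
    rw [ENNReal.tendsto_nhds_zero]
    intro η hη
    have hlim : Tendsto (fun ε : ℝ => ENNReal.ofReal (W * ε)) (𝓝[>] 0) (𝓝 0) := by
      have h1 : Continuous fun ε : ℝ => ENNReal.ofReal (W * ε) :=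
        ENNReal.continuous_ofReal.comp (continuous_const.mul continuous_id)
      have h2 := h1.tendsto 0
      rw [mul_zero, ENNReal.ofReal_zero] at h2
      exact h2.mono_left nhdsWithin_le_nhds
    obtain ⟨ε, hεη, hε⟩ := ((hlim.eventually (ge_mem_nhds hη)).and self_mem_nhdsWithin).exists
    filter_upwards [eventually_abs_sub_le hX hf hf₁ hε] with α hα
    refine iSup₂_le fun x _ => ?_
    by_cases hx : x ∈ dataHull X
    · exact (ENNReal.ofReal_le_ofReal (mul_le_mul (hW x hx) (hα.1 x hx) (abs_nonneg _) hW0)).trans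
        hεη
    · simp [hα.2 x hx]
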